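/- Let $K$ be a field. Let $\mathrm{BiCom}$ be the operad over $K$ of bicommutative algebras, i.e. the quotient of the free symmetric operad on one binary operation (without symmetry) by the operadic ideal generated by the identities $a(bc)=b(ac)$ and $(ab)c=(ac)b$. Let $\mathrm{Nov}$ be the operad over $K$ of Novikov algebras, defined in the same way by the identities $(ab)c-a(bc)=(ba)c-b(ac)$ and $(ab)c=(ac)b$ (these are satisfied by $a\prec b=a\,d(b)$ in a commutative associative algebra with a derivation $d$). For binary operads $P,Q$ let $P\otimes Q$ be their Hadamard product, $(P\otimes Q)(n)=P(n)\otimes_K Q(n)$, and let the white Manin product $P\circ Q$ be the suboperad of $P\otimes Q$ generated by $P(2)\otimes Q(2)$. Put $\operatorname{Der}P:=P\circ\mathrm{Nov}$. Then $$\mathrm{BiCom}\circ\mathrm{Nov}=\mathrm{BiCom}\otimes\mathrm{Nov},$$ and for every $n\ge 2$ $$\dim_K\operatorname{Der}\mathrm{BiCom}(n)=(2^n-2)\binom{2n-2}{n-1}.$$ -/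

import Mathlib

open scoped TensorProduct

universe u

/-! ### Inserting a finite set in place of a point -/

/-- The set obtained from `I` by replacing the point `i` by the set `J`. -/
abbrev Graft (I : Type) (i : I) (J : Type) : Type := {k : I // k ≠ i} ⊕ J

namespace Graft

/-- Functoriality of `Graft` under bijections. -/
def congr {I I' J J' : Type} (e : I ≃ I') (f : J ≃ J') (i : I) :
    Graft I i J ≃ Graft I' (e i) J' :=
  Equiv.sumCongr (e.subtypeEquiv fun k => by simp) f

/-- Nested insertion: inserting `L` at a point `j` of `J`, after or before `J` is inserted. -/
def assoc {I J : Type} (i : I) (j : J) (L : Type) :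
    Graft (Graft I i J) (Sum.inr j) L ≃ Graft I i (Graft J j L) where
  toFun x := match x with
    | Sum.inl ⟨Sum.inl k, _⟩ => Sum.inl k
    | Sum.inl ⟨Sum.inr l, h⟩ => Sum.inr (Sum.inl ⟨l, fun e => h (congrArg Sum.inr e)⟩)
    | Sum.inr x => Sum.inr (Sum.inr x)
  invFun x := match x with
    | Sum.inl k => Sum.inl ⟨Sum.inl k, fun h => nomatch h⟩
    | Sum.inr (Sum.inl l) => Sum.inl ⟨Sum.inr l.1, fun h => l.2 (Sum.inr.inj h)⟩
    | Sum.inr (Sum.inr x) => Sum.inr x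
  left_inv := by rintro (⟨k | l, h⟩ | x) <;> rfl
  right_inv := by rintro (k | l | x) <;> rfl

/-- The underlying function of `comm`. -/
def commFun {I : Type} (i k : I) (hik : i ≠ k) (J L : Type) :
    Graft (Graft I i J) (Sum.inl ⟨k, hik.symm⟩) L → Graft (Graft I k L) (Sum.inl ⟨i, hik⟩) J
  | Sum.inl ⟨Sum.inl a, h⟩ =>
      Sum.inl ⟨Sum.inl ⟨a.1, fun e => h (congrArg Sum.inl (Subtype.ext e))⟩,
        fun e => a.2 (congrArg Subtype.val (Sum.inl.inj e))⟩
  | Sum.inl ⟨Sum.inr j, _⟩ => Sum.inr j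
  | Sum.inr l => Sum.inl ⟨Sum.inr l, fun h => nomatch h⟩

/-- Disjoint insertion: inserting `J` at `i` and `L` at `k ≠ i`, in either order. -/
def comm {I : Type} (i k : I) (hik : i ≠ k) (J L : Type) :
    Graft (Graft I i J) (Sum.inl ⟨k, hik.symm⟩) L ≃
      Graft (Graft I k L) (Sum.inl ⟨i, hik⟩) J where
  toFun := commFun i k hik J L
  invFun := commFun k i hik.symm L J
  left_inv := by rintro (⟨k | l, h⟩ | x) <;> rfl
  right_inv := by rintro (⟨k | l, h⟩ | x) <;> rfl

open Classical in
/-- Replacing a point by a one-point set changes nothing. -/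
noncomputable def rightUnit {I : Type} (i : I) : Graft I i Unit ≃ I where
  toFun x := match x with
    | Sum.inl k => k.1
    | Sum.inr _ => i
  invFun a := if h : a = i then Sum.inr () else Sum.inl ⟨a, h⟩
  left_inv := by rintro (⟨k, h⟩ | x) <;> simp [*]
  right_inv a := by
    by_cases h : a = i <;> simp [h]

/-- Replacing the only point of a one-point set by `J` gives `J`. -/
def leftUnit (J : Type) : Graft Unit () J ≃ J where
  toFun x := match x with
    | Sum.inl k => absurd rfl k.2
    | Sum.inr j => j
  invFun := Sum.inr
  left_inv := by rintro (⟨k, h⟩ | x) <;> [exact absurd rfl h; rfl]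
  right_inv _ := rfl

end Graft

/-! ### Symmetric operads -/

/-- A symmetric operad in vector spaces over `K`, in the coordinate-free form: `carrier I` is the
space of operations whose inputs are labelled by the finite set `I` (so the component of arity
`n` is `carrier (Fin n)`, and `relabel` restricts to the action of the symmetric group on it), and
`comp i a b` is the partial composition `a ∘_i b`. -/
structure SymmOperad (K : Type u) [Field K] where
  carrier : (I : Type) → [Finite I] → Type u
  [addCommGroup : ∀ (I : Type) [Finite I], AddCommGroup (carrier I)]
  [module : ∀ (I : Type) [Finite I], Module K (carrier I)]
  relabel : ∀ {I J : Type} [Finite I] [Finite J], (I ≃ J) → (carrier I →ₗ[K] carrier J)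
  one : carrier Unit
  comp : ∀ {I J : Type} [Finite I] [Finite J] (i : I),
    carrier I →ₗ[K] carrier J →ₗ[K] carrier (Graft I i J)
  relabel_refl : ∀ {I : Type} [Finite I] (a : carrier I), relabel (Equiv.refl I) a = a
  relabel_trans : ∀ {I J L : Type} [Finite I] [Finite J] [Finite L] (e : I ≃ J) (f : J ≃ L)
    (a : carrier I), relabel (e.trans f) a = relabel f (relabel e a)
  comp_relabel : ∀ {I I' J J' : Type} [Finite I] [Finite I'] [Finite J] [Finite J']
    (e : I ≃ I') (f : J ≃ J') (i : I) (a : carrier I) (b : carrier J),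
    comp (e i) (relabel e a) (relabel f b) = relabel (Graft.congr e f i) (comp i a b)
  comp_one : ∀ {I : Type} [Finite I] (i : I) (a : carrier I),
    relabel (Graft.rightUnit i) (comp i a one) = a
  one_comp : ∀ {J : Type} [Finite J] (b : carrier J),
    relabel (Graft.leftUnit J) (comp () one b) = b
  comp_assoc : ∀ {I J L : Type} [Finite I] [Finite J] [Finite L] (i : I) (j : J)
    (a : carrier I) (b : carrier J) (c : carrier L),
    relabel (Graft.assoc i j L) (comp (Sum.inr j) (comp i a b) c) = comp i a (comp j b c)
  comp_comm : ∀ {I J L : Type} [Finite I] [Finite J] [Finite L] (i k : I) (hik : i ≠ k)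
    (a : carrier I) (b : carrier J) (c : carrier L),
    relabel (Graft.comm i k hik J L) (comp (Sum.inl ⟨k, hik.symm⟩) (comp i a b) c) =
      comp (Sum.inl ⟨i, hik⟩) (comp k a c) b

attribute [instance] SymmOperad.addCommGroup SymmOperad.module

namespace SymmOperad

variable {K : Type u} [Field K]

/-! ### Hadamard product -/

/-- The Hadamard product `P ⊗ Q`: `(P ⊗ Q)(I) = P(I) ⊗ Q(I)` with componentwise structure. -/
noncomputable def hadamard (P Q : SymmOperad K) : SymmOperad K where
  carrier I _ := P.carrier I ⊗[K] Q.carrier I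
  relabel e := TensorProduct.map (P.relabel e) (Q.relabel e)
  one := P.one ⊗ₜ[K] Q.one
  comp i := TensorProduct.map₂ (P.comp i) (Q.comp i)
  relabel_refl a := by
    induction a using TensorProduct.induction_on with
    | zero => simp
    | tmul x y => simp [relabel_refl]
    | add x y hx hy => rw [map_add, hx, hy]
  relabel_trans e f a := by
    induction a using TensorProduct.induction_on with
    | zero => simp
    | tmul x y => simp [relabel_trans]
    | add x y hx hy => simp only [map_add, hx, hy]
  comp_relabel e f i a b := by
    induction a using TensorProduct.induction_on with
    | zero => simp
    | add x y hx hy => simp only [map_add, LinearMap.add_apply, hx, hy]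
    | tmul x y =>
      induction b using TensorProduct.induction_on with
      | zero => simp
      | add x y hx hy => simp only [map_add, hx, hy]
      | tmul x' y' => simp [comp_relabel]
  comp_one i a := by
    induction a using TensorProduct.induction_on with
    | zero => simp
    | add x y hx hy => simp only [map_add, LinearMap.add_apply, hx, hy]
    | tmul x y => simp [comp_one]
  one_comp b := by
    induction b using TensorProduct.induction_on with
    | zero => simp
    | add x y hx hy => simp only [map_add, hx, hy]
    | tmul x y => simp [one_comp]
  comp_assoc i j a b c := by
    induction a using TensorProduct.induction_on with
    | zero => simp
    | add x y hx hy => simp only [map_add, LinearMap.add_apply, hx, hy]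
    | tmul x y =>
      induction b using TensorProduct.induction_on with
      | zero => simp
      | add x y hx hy => simp only [map_add, LinearMap.add_apply, hx, hy]
      | tmul x' y' =>
        induction c using TensorProduct.induction_on with
        | zero => simp
        | add x y hx hy => simp only [map_add, hx, hy]
        | tmul x'' y'' => simp [comp_assoc]
  comp_comm i k hik a b c := by
    induction a using TensorProduct.induction_on with
    | zero => simp
    | add x y hx hy => simp only [map_add, LinearMap.add_apply, hx, hy]
    | tmul x y =>
      induction b using TensorProduct.induction_on with
      | zero => simp
      | add x y hx hy => simp only [map_add, LinearMap.add_apply, hx, hy]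
      | tmul x' y' =>
        induction c using TensorProduct.induction_on with
        | zero => simp
        | add x y hx hy => simp only [map_add, LinearMap.add_apply, hx, hy]
        | tmul x'' y'' => simp [comp_comm]

/-! ### Suboperads and the white Manin product -/

/-- A suboperad of `P`. -/
@[ext]
structure Suboperad (P : SymmOperad K) where
  carrier : (I : Type) → [Finite I] → Submodule K (P.carrier I)
  relabel_mem : ∀ {I J : Type} [Finite I] [Finite J] (e : I ≃ J) {a : P.carrier I},
    a ∈ carrier I → P.relabel e a ∈ carrier J
  one_mem : P.one ∈ carrier Unit
  comp_mem : ∀ {I J : Type} [Finite I] [Finite J] (i : I) {a : P.carrier I} {b : P.carrier J},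
    a ∈ carrier I → b ∈ carrier J → P.comp i a b ∈ carrier (Graft I i J)

namespace Suboperad

/-- The whole operad, as a suboperad of itself. -/
instance (P : SymmOperad K) : Top (Suboperad P) where
  top :=
    { carrier := fun _ _ => ⊤
      relabel_mem := fun _ _ _ => trivial
      one_mem := trivial
      comp_mem := fun _ _ _ _ _ => trivial }

/-- A suboperad is an operad in its own right. -/
def toOperad {P : SymmOperad K} (S : Suboperad P) : SymmOperad K where
  carrier I _ := S.carrier I
  relabel e := (P.relabel e).restrict fun _ h => S.relabel_mem e h
  one := ⟨P.one, S.one_mem⟩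
  comp i := LinearMap.mk₂ K (fun a b => ⟨P.comp i a b, S.comp_mem i a.2 b.2⟩)
    (fun a a' b => Subtype.ext (by simp)) (fun c a b => Subtype.ext (by simp))
    (fun a b b' => Subtype.ext (by simp)) (fun c a b => Subtype.ext (by simp))
  relabel_refl a := Subtype.ext (P.relabel_refl a.1)
  relabel_trans e f a := Subtype.ext (P.relabel_trans e f a.1)
  comp_relabel e f i a b := Subtype.ext (P.comp_relabel e f i a.1 b.1)
  comp_one i a := Subtype.ext (P.comp_one i a.1)
  one_comp b := Subtype.ext (P.one_comp b.1)
  comp_assoc i j a b c := Subtype.ext (P.comp_assoc i j a.1 b.1 c.1)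
  comp_comm i k hik a b c := Subtype.ext (P.comp_comm i k hik a.1 b.1 c.1)

/-- The suboperad generated by the arity two component: the intersection of all suboperads that
contain every operation of arity two. -/
def generatedByBinary (P : SymmOperad K) : Suboperad P where
  carrier I _ := ⨅ (S : Suboperad P) (_ : S.carrier (Fin 2) = ⊤), S.carrier I
  relabel_mem e a ha := by
    simp only [Submodule.mem_iInf] at ha ⊢
    exact fun S hS => S.relabel_mem e (ha S hS)
  one_mem := by
    simp only [Submodule.mem_iInf]
    exact fun S _ => S.one_mem
  comp_mem i a b ha hb := by
    simp only [Submodule.mem_iInf] at ha hb ⊢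
    exact fun S hS => S.comp_mem i (ha S hS) (hb S hS)

end Suboperad

/-- The white Manin product `P ∘ Q` of binary operads: the suboperad of the Hadamard product
`P ⊗ Q` generated by `P(2) ⊗ Q(2)`. -/
noncomputable def whiteManin (P Q : SymmOperad K) : Suboperad (hadamard P Q) :=
  Suboperad.generatedByBinary (hadamard P Q)

/-! ### Operadic ideals and quotients -/

/-- An ideal of the operad `P`. -/
structure OperadIdeal (P : SymmOperad K) where
  carrier : (I : Type) → [Finite I] → Submodule K (P.carrier I)
  relabel_mem : ∀ {I J : Type} [Finite I] [Finite J] (e : I ≃ J) {a : P.carrier I},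
    a ∈ carrier I → P.relabel e a ∈ carrier J
  comp_mem_left : ∀ {I J : Type} [Finite I] [Finite J] (i : I) {a : P.carrier I}
    (b : P.carrier J), a ∈ carrier I → P.comp i a b ∈ carrier (Graft I i J)
  comp_mem_right : ∀ {I J : Type} [Finite I] [Finite J] (i : I) (a : P.carrier I)
    {b : P.carrier J}, b ∈ carrier J → P.comp i a b ∈ carrier (Graft I i J)

namespace OperadIdeal

/-- The ideal generated by a set of operations of arity three. -/
def span (P : SymmOperad K) (R : Set (P.carrier (Fin 3))) : OperadIdeal P where
  carrier I _ := ⨅ (N : OperadIdeal P) (_ : R ⊆ N.carrier (Fin 3)), N.carrier I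
  relabel_mem e a ha := by
    simp only [Submodule.mem_iInf] at ha ⊢
    exact fun N hN => N.relabel_mem e (ha N hN)
  comp_mem_left i a b ha := by
    simp only [Submodule.mem_iInf] at ha ⊢
    exact fun N hN => N.comp_mem_left i b (ha N hN)
  comp_mem_right i a b hb := by
    simp only [Submodule.mem_iInf] at hb ⊢
    exact fun N hN => N.comp_mem_right i a (hb N hN)

/-- The composition of a quotient operad. -/
def quotientComp {P : SymmOperad K} (N : OperadIdeal P) {I J : Type} [Finite I] [Finite J]
    (i : I) : (P.carrier I ⧸ N.carrier I) →ₗ[K] (P.carrier J ⧸ N.carrier J) →ₗ[K]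
      (P.carrier (Graft I i J) ⧸ N.carrier (Graft I i J)) :=
  Submodule.liftQ (N.carrier I)
    (LinearMap.flip (Submodule.liftQ (N.carrier J)
      (LinearMap.flip ((P.comp i).compr₂ (N.carrier (Graft I i J)).mkQ))
      fun b hb => LinearMap.mem_ker.2 (LinearMap.ext fun a =>
        (Submodule.Quotient.mk_eq_zero _).2 (N.comp_mem_right i a hb))))
    fun a ha => by
      refine LinearMap.mem_ker.2 (LinearMap.ext fun b => ?_)
      obtain ⟨b, rfl⟩ := Submodule.Quotient.mk_surjective _ b
      exact (Submodule.Quotient.mk_eq_zero _).2 (N.comp_mem_left i b ha)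

/-- The quotient operad `P / N`. -/
def quotient {P : SymmOperad K} (N : OperadIdeal P) : SymmOperad K where
  carrier I _ := P.carrier I ⧸ N.carrier I
  relabel {I J} _ _ e :=
    Submodule.mapQ (N.carrier I) (N.carrier J) (P.relabel e) fun _ h => N.relabel_mem e h
  one := Submodule.Quotient.mk P.one
  comp i := N.quotientComp i
  relabel_refl a := by
    obtain ⟨a, rfl⟩ := Submodule.Quotient.mk_surjective _ a
    exact congrArg Submodule.Quotient.mk (P.relabel_refl a)
  relabel_trans e f a := by
    obtain ⟨a, rfl⟩ := Submodule.Quotient.mk_surjective _ a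
    exact congrArg Submodule.Quotient.mk (P.relabel_trans e f a)
  comp_relabel e f i a b := by
    obtain ⟨a, rfl⟩ := Submodule.Quotient.mk_surjective _ a
    obtain ⟨b, rfl⟩ := Submodule.Quotient.mk_surjective _ b
    exact congrArg Submodule.Quotient.mk (P.comp_relabel e f i a b)
  comp_one i a := by
    obtain ⟨a, rfl⟩ := Submodule.Quotient.mk_surjective _ a
    exact congrArg Submodule.Quotient.mk (P.comp_one i a)
  one_comp b := by
    obtain ⟨b, rfl⟩ := Submodule.Quotient.mk_surjective _ b
    exact congrArg Submodule.Quotient.mk (P.one_comp b)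
  comp_assoc i j a b c := by
    obtain ⟨a, rfl⟩ := Submodule.Quotient.mk_surjective _ a
    obtain ⟨b, rfl⟩ := Submodule.Quotient.mk_surjective _ b
    obtain ⟨c, rfl⟩ := Submodule.Quotient.mk_surjective _ c
    exact congrArg Submodule.Quotient.mk (P.comp_assoc i j a b c)
  comp_comm i k hik a b c := by
    obtain ⟨a, rfl⟩ := Submodule.Quotient.mk_surjective _ a
    obtain ⟨b, rfl⟩ := Submodule.Quotient.mk_surjective _ b
    obtain ⟨c, rfl⟩ := Submodule.Quotient.mk_surjective _ c
    exact congrArg Submodule.Quotient.mk (P.comp_comm i k hik a b c)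

end OperadIdeal

end SymmOperad

/-! ### The free operad on one binary operation -/

/-- The letters of a nonassociative word, from left to right. -/
def FreeMagma.letters {I : Type} : FreeMagma I → List I
  | FreeMagma.of i => [i]
  | FreeMagma.mul s t => FreeMagma.letters s ++ FreeMagma.letters t

/-- Multilinear nonassociative monomials: every letter of `I` occurs exactly once. -/
def MultilinearWord (I : Type) : Type :=
  {t : FreeMagma I // t.letters.Nodup ∧ ∀ i, i ∈ t.letters}

namespace MultilinearWord

open Classical in
/-- The substitution that replaces the letter `i` by the word `s`. -/
noncomputable def substLetter {I J : Type} (i : I) (s : FreeMagma J) (k : I) :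
    FreeMagma (Graft I i J) :=
  if h : k = i then FreeMagma.map Sum.inr s else FreeMagma.of (Sum.inl ⟨k, h⟩)

theorem letters_mul {I : Type} (s t : FreeMagma I) :
    (s * t).letters = s.letters ++ t.letters := rfl

theorem letters_map {I J : Type} (f : I → J) (t : FreeMagma I) :
    (FreeMagma.map f t).letters = t.letters.map f := by
  induction t using FreeMagma.recOnMul with
  | ih1 i => rfl
  | ih2 s t hs ht => simp only [map_mul, letters_mul, hs, ht, List.map_append]

theorem letters_lift {I J : Type} (f : I → FreeMagma J) (t : FreeMagma I) :
    (FreeMagma.lift f t).letters = t.letters.flatMap fun i => (f i).letters := by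
  induction t using FreeMagma.recOnMul with
  | ih1 i => simp [FreeMagma.letters]
  | ih2 s t hs ht => simp only [map_mul, letters_mul, hs, ht, List.flatMap_append]

/-- Renaming of letters. -/
def relabel {I J : Type} (e : I ≃ J) (t : MultilinearWord I) : MultilinearWord J :=
  ⟨FreeMagma.map e t.1, by
    rw [letters_map]
    exact ⟨t.2.1.map e.injective,
      fun j => List.mem_map.2 ⟨e.symm j, t.2.2 _, e.apply_symm_apply j⟩⟩⟩

/-- Substitution of the word `s` for the letter `i` of the word `t`. -/
noncomputable def subst {I J : Type} (i : I) (t : MultilinearWord I) (s : MultilinearWord J) :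
    MultilinearWord (Graft I i J) :=
  ⟨FreeMagma.lift (substLetter i s.1) t.1, by
    rw [letters_lift]
    constructor
    · rw [List.nodup_flatMap]
      constructor
      · intro k _
        by_cases h : k = i
        · simpa [substLetter, h, letters_map] using s.2.1.map Sum.inr_injective
        · simp [substLetter, h, FreeMagma.letters]
      · refine t.2.1.imp fun {a b} hab => ?_
        intro x hx hy
        by_cases ha : a = i <;> by_cases hb : b = i
        · exact hab (ha.trans hb.symm)
        · simp [substLetter, ha, hb, letters_map, FreeMagma.letters] at hx hy
          grind
        · simp [substLetter, ha, hb, letters_map, FreeMagma.letters] at hx hy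
          grind
        · simp [substLetter, ha, hb, FreeMagma.letters] at hx hy
          grind
    · rintro (⟨k, hk⟩ | j)
      · exact List.mem_flatMap.2 ⟨k, t.2.2 k, by simp [substLetter, hk, FreeMagma.letters]⟩
      · exact List.mem_flatMap.2 ⟨i, t.2.2 i, by simp [substLetter, letters_map, s.2.2 j]⟩⟩

theorem relabel_refl {I : Type} (t : MultilinearWord I) : relabel (Equiv.refl I) t = t := by
  obtain ⟨t, ht⟩ := t
  refine Subtype.ext ?_
  change FreeMagma.map id t = t
  clear ht
  induction t using FreeMagma.recOnMul with
  | ih1 i => rfl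
  | ih2 s t hs ht => rw [map_mul, hs, ht]

theorem map_map {I J L : Type} (f : I → J) (g : J → L) (t : FreeMagma I) :
    FreeMagma.map g (FreeMagma.map f t) = FreeMagma.map (fun i => g (f i)) t := by
  induction t using FreeMagma.recOnMul with
  | ih1 i => rfl
  | ih2 s t hs ht => simp only [map_mul, hs, ht]

theorem map_lift {I J L : Type} (f : I → FreeMagma J) (g : J → L) (t : FreeMagma I) :
    FreeMagma.map g (FreeMagma.lift f t) =
      FreeMagma.lift (fun i => FreeMagma.map g (f i)) t := by
  induction t using FreeMagma.recOnMul with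
  | ih1 i => simp
  | ih2 s t hs ht => simp only [map_mul, hs, ht]

theorem lift_map {I J L : Type} (f : I → J) (g : J → FreeMagma L) (t : FreeMagma I) :
    FreeMagma.lift g (FreeMagma.map f t) = FreeMagma.lift (fun i => g (f i)) t := by
  induction t using FreeMagma.recOnMul with
  | ih1 i => simp
  | ih2 s t hs ht => simp only [map_mul, hs, ht]

theorem lift_lift {I J L : Type} (f : I → FreeMagma J) (g : J → FreeMagma L) (t : FreeMagma I) :
    FreeMagma.lift g (FreeMagma.lift f t) =
      FreeMagma.lift (fun i => FreeMagma.lift g (f i)) t := by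
  induction t using FreeMagma.recOnMul with
  | ih1 i => simp
  | ih2 s t hs ht => simp only [map_mul, hs, ht]

theorem lift_of {I J : Type} (f : I → J) (t : FreeMagma I) :
    FreeMagma.lift (fun i => FreeMagma.of (f i)) t = FreeMagma.map f t := rfl

theorem relabel_trans {I J L : Type} (e : I ≃ J) (f : J ≃ L) (t : MultilinearWord I) :
    relabel (e.trans f) t = relabel f (relabel e t) :=
  Subtype.ext (map_map e f t.1).symm

theorem subst_relabel {I I' J J' : Type} (e : I ≃ I') (f : J ≃ J') (i : I)
    (t : MultilinearWord I) (s : MultilinearWord J) :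
    subst (e i) (relabel e t) (relabel f s) = relabel (Graft.congr e f i) (subst i t s) := by
  refine Subtype.ext ?_
  simp only [subst, relabel, lift_map, map_lift]
  congr 2
  funext k
  by_cases h : k = i
  · subst h
    simp only [substLetter, dif_pos, map_map]
    rfl
  · have h' : e k ≠ e i := fun h' => h (e.injective h')
    simp only [substLetter, dif_neg h, dif_neg h']
    rfl

/-- The word with a single letter. -/
def unit : MultilinearWord Unit :=
  ⟨FreeMagma.of (), by simp [FreeMagma.letters]⟩

theorem subst_unit {I : Type} (i : I) (t : MultilinearWord I) :
    relabel (Graft.rightUnit i) (subst i t unit) = t := by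
  refine Eq.trans (Subtype.ext ?_) (relabel_refl t)
  simp only [subst, relabel, map_lift]
  rw [← lift_of]
  congr 2
  funext k
  by_cases h : k = i
  · subst h
    simp only [substLetter, dif_pos]
    rfl
  · simp only [substLetter, dif_neg h]
    rfl

theorem unit_subst {J : Type} (s : MultilinearWord J) :
    relabel (Graft.leftUnit J) (subst () unit s) = s := by
  refine Eq.trans (Subtype.ext ?_) (relabel_refl s)
  simp only [subst, relabel, unit, FreeMagma.lift_of, substLetter, dif_pos, map_map]
  rfl

theorem subst_assoc {I J L : Type} (i : I) (j : J) (t : MultilinearWord I)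
    (s : MultilinearWord J) (r : MultilinearWord L) :
    relabel (Graft.assoc i j L) (subst (Sum.inr j) (subst i t s) r) =
      subst i t (subst j s r) := by
  refine Subtype.ext ?_
  simp only [subst, relabel, map_lift, lift_lift]
  congr 2
  funext k
  by_cases h : k = i
  · subst h
    simp only [substLetter, dif_pos, lift_map, map_lift]
    congr 2
    funext l
    by_cases hl : l = j
    · subst hl
      simp only [dif_pos, map_map]
      rfl
    · have hl' : (Sum.inr l : Graft I k J) ≠ Sum.inr j := fun h' => hl (Sum.inr.inj h')
      simp only [dif_neg hl, dif_neg hl']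
      rfl
  · simp only [substLetter, dif_neg h, FreeMagma.lift_of]
    rw [dif_neg (fun h' => nomatch h')]
    rfl

theorem subst_comm {I J L : Type} (i k : I) (hik : i ≠ k) (t : MultilinearWord I)
    (s : MultilinearWord J) (r : MultilinearWord L) :
    relabel (Graft.comm i k hik J L) (subst (Sum.inl ⟨k, hik.symm⟩) (subst i t s) r) =
      subst (Sum.inl ⟨i, hik⟩) (subst k t r) s := by
  refine Subtype.ext ?_
  simp only [subst, relabel, map_lift, lift_lift]
  congr 2
  funext a
  by_cases h : a = i
  · subst h
    simp only [substLetter, dif_pos, dif_neg hik, lift_map, FreeMagma.lift_of]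
    rw [← lift_of]
    congr 2
    funext l
    rw [dif_neg (fun h' => nomatch h')]
    rfl
  · by_cases h' : a = k
    · subst h'
      simp only [substLetter, dif_pos, dif_neg h, lift_map, FreeMagma.lift_of, map_map]
      rw [← lift_of]
      congr 2
      funext l
      rw [dif_neg (fun h' => nomatch h')]
      rfl
    · simp only [substLetter, dif_neg h, dif_neg h', FreeMagma.lift_of]
      rw [dif_neg (fun e => h' (congrArg Subtype.val (Sum.inl.inj e))),
        dif_neg (fun e => h (congrArg Subtype.val (Sum.inl.inj e)))]
      rfl

end MultilinearWord

/-- The bilinear extension of the substitution of words. -/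
noncomputable def magComp (K : Type u) [Field K] {I J : Type} (i : I) :
    (MultilinearWord I →₀ K) →ₗ[K] (MultilinearWord J →₀ K) →ₗ[K]
      (MultilinearWord (Graft I i J) →₀ K) :=
  Finsupp.linearCombination K fun t => Finsupp.lmapDomain K K (MultilinearWord.subst i t)

theorem magComp_single (K : Type u) [Field K] {I J : Type} (i : I) (t : MultilinearWord I)
    (s : MultilinearWord J) (c d : K) :
    magComp K i (Finsupp.single t c) (Finsupp.single s d) =
      Finsupp.single (MultilinearWord.subst i t s) (c * d) := by
  rw [magComp, Finsupp.linearCombination_single, LinearMap.smul_apply, Finsupp.lmapDomain_apply,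
    Finsupp.mapDomain_single, Finsupp.smul_single, smul_eq_mul]

/-- The free operad on one binary operation without symmetry (the operad of all nonassociative
algebras): `Mag(I)` has the multilinear nonassociative monomials in the letters `I` as a basis, and
composition is substitution. -/
noncomputable def Mag (K : Type u) [Field K] : SymmOperad K where
  carrier I _ := MultilinearWord I →₀ K
  relabel e := Finsupp.lmapDomain K K (MultilinearWord.relabel e)
  one := Finsupp.single MultilinearWord.unit 1
  comp i := magComp K i
  relabel_refl a := by
    induction a using Finsupp.induction_linear with
    | zero => simp
    | add x y hx hy => simp only [map_add, hx, hy]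
    | single t c => simp [MultilinearWord.relabel_refl]
  relabel_trans e f a := by
    induction a using Finsupp.induction_linear with
    | zero => simp
    | add x y hx hy => simp only [map_add, hx, hy]
    | single t c => simp [MultilinearWord.relabel_trans]
  comp_relabel e f i a b := by
    induction a using Finsupp.induction_linear with
    | zero => simp
    | add x y hx hy => simp only [map_add, LinearMap.add_apply, hx, hy]
    | single t c =>
      induction b using Finsupp.induction_linear with
      | zero => simp
      | add x y hx hy => simp only [map_add, hx, hy]
      | single s d => simp only [magComp_single, Finsupp.lmapDomain_apply, Finsupp.mapDomain_single,
            MultilinearWord.subst_relabel]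
  comp_one i a := by
    induction a using Finsupp.induction_linear with
    | zero => simp
    | add x y hx hy => simp only [map_add, LinearMap.add_apply, hx, hy]
    | single t c => simp [magComp_single, MultilinearWord.subst_unit]
  one_comp b := by
    induction b using Finsupp.induction_linear with
    | zero => simp
    | add x y hx hy => simp only [map_add, hx, hy]
    | single t c => simp [magComp_single, MultilinearWord.unit_subst]
  comp_assoc i j a b c := by
    induction a using Finsupp.induction_linear with
    | zero => simp
    | add x y hx hy => simp only [map_add, LinearMap.add_apply, hx, hy]
    | single t x =>
      induction b using Finsupp.induction_linear with
      | zero => simp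
      | add x y hx hy => simp only [map_add, LinearMap.add_apply, hx, hy]
      | single s y =>
        induction c using Finsupp.induction_linear with
        | zero => simp
        | add x y hx hy => simp only [map_add, hx, hy]
        | single r z => simp only [magComp_single, Finsupp.lmapDomain_apply, Finsupp.mapDomain_single,
            MultilinearWord.subst_assoc, mul_assoc]
  comp_comm i k hik a b c := by
    induction a using Finsupp.induction_linear with
    | zero => simp
    | add x y hx hy => simp only [map_add, LinearMap.add_apply, hx, hy]
    | single t x =>
      induction b using Finsupp.induction_linear with
      | zero => simp
      | add x y hx hy => simp only [map_add, LinearMap.add_apply, hx, hy]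
      | single s y =>
        induction c using Finsupp.induction_linear with
        | zero => simp
        | add x y hx hy => simp only [map_add, LinearMap.add_apply, hx, hy]
        | single r z => simp only [magComp_single, Finsupp.lmapDomain_apply, Finsupp.mapDomain_single,
            MultilinearWord.subst_comm, mul_right_comm]

/-! ### The operads of bicommutative and of Novikov algebras -/

/-- For a permutation `p` of the three letters, the monomial `(x_{p 0} x_{p 1}) x_{p 2}`. -/
noncomputable def leftMonomial (K : Type u) [Field K] (p : Equiv.Perm (Fin 3)) :
    (Mag K).carrier (Fin 3) :=
  Finsupp.single (MultilinearWord.relabel p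
    ⟨(FreeMagma.of 0 * FreeMagma.of 1) * FreeMagma.of 2,
      by change [0, 1, 2].Nodup ∧ ∀ i : Fin 3, i ∈ [0, 1, 2]; decide⟩) 1

/-- For a permutation `p` of the three letters, the monomial `x_{p 0} (x_{p 1} x_{p 2})`. -/
noncomputable def rightMonomial (K : Type u) [Field K] (p : Equiv.Perm (Fin 3)) :
    (Mag K).carrier (Fin 3) :=
  Finsupp.single (MultilinearWord.relabel p
    ⟨FreeMagma.of 0 * (FreeMagma.of 1 * FreeMagma.of 2),
      by change [0, 1, 2].Nodup ∧ ∀ i : Fin 3, i ∈ [0, 1, 2]; decide⟩) 1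

/-- The operad of bicommutative algebras: `a(bc) = b(ac)` and `(ab)c = (ac)b`. -/
noncomputable def BiCom (K : Type u) [Field K] : SymmOperad K :=
  (SymmOperad.OperadIdeal.span (Mag K)
    {rightMonomial K 1 - rightMonomial K (Equiv.swap 0 1),
      leftMonomial K 1 - leftMonomial K (Equiv.swap 1 2)}).quotient

/-- The operad of Novikov algebras: `(ab)c - a(bc) = (ba)c - b(ac)` and `(ab)c = (ac)b`, the
identities satisfied by `a ≺ b = a d(b)` in commutative associative algebras with a
derivation `d`. -/
noncomputable def Nov (K : Type u) [Field K] : SymmOperad K :=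
  (SymmOperad.OperadIdeal.span (Mag K)
    {(leftMonomial K 1 - rightMonomial K 1) -
        (leftMonomial K (Equiv.swap 0 1) - rightMonomial K (Equiv.swap 0 1)),
      leftMonomial K 1 - leftMonomial K (Equiv.swap 1 2)}).quotient

/-- The derived operad `Der P = P ∘ Nov`. -/
noncomputable def Der {K : Type u} [Field K] (P : SymmOperad K) : SymmOperad K :=
  (SymmOperad.whiteManin P (Nov K)).toOperad

/-! ### Evaluation of operations in algebras -/

/-! The theorem is a squeeze of dimensions, valid in every characteristic.

Upper bound. In a bicommutative algebra a product of n ≥ 2 letters depends only on which letters are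
left children and which are right children in its tree, and both kinds occur; so dim BiCom(n) ≤ 2^n
- 2 (`Bicommutative.finrank_le`). In a Novikov algebra every multilinear word is a combination of
elements that imitate the differential monomials ∏ d^(a_i)(x_i) with ∑ a_i = n - 1; so dim Nov(n) ≤
C(2n-2, n-1) (`Novikov.finrank_le`). `Mag.finrank_quotient_le` turns such spanning statements, valid
in all algebras of the variety, into bounds for the operad, by means of a relatively free algebra.

Lower bound. Let S be a suboperad of the Hadamard product that contains all binary operations.
Evaluate BiCom on pairs with (a, b)(c, e) = (ae, ae), so that a letter contributes its first
coordinate as a left child and its second as a right child. Evaluate Nov on differential polynomials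
with a d(b), and multiply the two values. Since S(2) is the whole tensor product, the side of a
letter and the place of the derivative are chosen independently, and the values are closed under p ↦
x d(p) and p ↦ d(x) p for a letter x on either side. By `SidedMonomial.Closed.value_mem` these
operations reach every monomial in n letters of total order n - 1 with both sides present. There are
(2^n - 2) C(2n-2, n-1) multilinear ones, and they are linearly independent
(`BiComNov.linearIndependent_value`).

The two bounds agree, so S(n) is the whole space for n ≥ 2. Arities 0 and 1 are checked directly. -/

namespace FreeMagma

variable {K A : Type*} [Field K] [AddCommGroup A] [Module K A]

/-- The value of a nonassociative word in an algebra. -/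
def evalWord (mul : A →ₗ[K] A →ₗ[K] A) {I : Type} (v : I → A) : FreeMagma I → A
  | FreeMagma.of i => v i
  | FreeMagma.mul s t => mul (evalWord mul v s) (evalWord mul v t)

variable (mul : A →ₗ[K] A →ₗ[K] A) {I J : Type}

@[simp] theorem evalWord_of (v : I → A) (i : I) : evalWord mul v (FreeMagma.of i) = v i := rfl

@[simp] theorem evalWord_mul (v : I → A) (s t : FreeMagma I) :
    evalWord mul v (s * t) = mul (evalWord mul v s) (evalWord mul v t) := rfl

theorem evalWord_lift (f : J → FreeMagma I) (v : I → A) (t : FreeMagma J) :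
    evalWord mul v (FreeMagma.lift f t) = evalWord mul (fun j => evalWord mul v (f j)) t := by
  induction t using FreeMagma.recOnMul with
  | ih1 i => simp
  | ih2 s t hs ht => simp only [map_mul, evalWord_mul, hs, ht]

theorem evalWord_map (f : J → I) (v : I → A) (t : FreeMagma J) :
    evalWord mul v (FreeMagma.map f t) = evalWord mul (fun j => v (f j)) t := by
  induction t using FreeMagma.recOnMul with
  | ih1 i => rfl
  | ih2 s t hs ht => simp only [map_mul, evalWord_mul, hs, ht]

theorem evalWord_congr {v w : I → A} (t : FreeMagma I) (h : ∀ i ∈ t.letters, v i = w i) :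
    evalWord mul v t = evalWord mul w t := by
  induction t using FreeMagma.recOnMul with
  | ih1 i => exact h i (by simp [letters])
  | ih2 s t hs ht =>
    rw [evalWord_mul, evalWord_mul,
      hs fun i hi => h i (by rw [MultilinearWord.letters_mul]; simp [hi]),
      ht fun i hi => h i (by rw [MultilinearWord.letters_mul]; simp [hi])]

open Classical in
-- Since the letter occurs exactly once, only one factor of each product depends on it. This
-- linearity in each argument underlies the compatibility of evaluation with composition.
theorem exists_evalWord_update_eq (v : I → A) (i : I) (t : FreeMagma I) (ht : t.letters.Nodup)
    (hi : i ∈ t.letters) :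
    ∃ F : A →ₗ[K] A, ∀ x, evalWord mul (Function.update v i x) t = F x := by
  induction t using FreeMagma.recOnMul with
  | ih1 j =>
    obtain rfl : i = j := by simpa [letters] using hi
    exact ⟨LinearMap.id, fun x => by simp⟩
  | ih2 s t hs ht' =>
    rw [MultilinearWord.letters_mul, List.nodup_append] at ht
    rw [MultilinearWord.letters_mul, List.mem_append] at hi
    rcases hi with hi | hi
    · obtain ⟨F, hF⟩ := hs ht.1 hi
      refine ⟨mul.flip (evalWord mul v t) ∘ₗ F, fun x => ?_⟩
      have : evalWord mul (Function.update v i x) t = evalWord mul v t :=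
        evalWord_congr mul t fun j hj => Function.update_of_ne (ht.2.2 i hi j hj).symm _ _
      simp [hF, this]
    · obtain ⟨F, hF⟩ := ht' ht.2.1 hi
      refine ⟨mul (evalWord mul v s) ∘ₗ F, fun x => ?_⟩
      have : evalWord mul (Function.update v i x) s = evalWord mul v s :=
        evalWord_congr mul s fun j hj => Function.update_of_ne (ht.2.2 j hj i hi) _ _
      simp [hF, this]

end FreeMagma

namespace Mag

open FreeMagma

variable {K : Type u} [Field K]

/-- A multilinear word as an element of the free operad. -/
noncomputable def word {I : Type} [Finite I] (t : MultilinearWord I) : (Mag K).carrier I :=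
  Finsupp.single t 1

theorem hom_ext {M : Type*} {I : Type} [Finite I] [AddCommGroup M] [Module K M]
    {f g : (Mag K).carrier I →ₗ[K] M} (h : ∀ t, f (word t) = g (word t)) : f = g :=
  Finsupp.lhom_ext' (M := K) (R := K) (φ := f) (ψ := g) fun t => LinearMap.ext_ring (h t)

theorem comp_word {I J : Type} [Finite I] [Finite J] (i : I) (t : MultilinearWord I)
    (s : MultilinearWord J) :
    (Mag K).comp i (word t) (word s) = word (MultilinearWord.subst i t s) :=
  (magComp_single K i t s 1 1).trans (by rw [mul_one]; rfl)

theorem relabel_word {I J : Type} [Finite I] [Finite J] (e : I ≃ J) (t : MultilinearWord I) :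
    (Mag K).relabel e (word t) = word (MultilinearWord.relabel e t) :=
  Finsupp.mapDomain_single

theorem span_range_word (I : Type) [Finite I] :
    Submodule.span K (Set.range (word : MultilinearWord I → (Mag K).carrier I)) = ⊤ := by
  by_contra h
  obtain ⟨f, hf, h'⟩ := Submodule.exists_le_ker_of_lt_top _ (lt_top_iff_ne_top.2 h)
  exact hf (hom_ext fun t => by simpa using h' (Submodule.subset_span ⟨t, rfl⟩))

section eval

variable {A : Type*} [AddCommGroup A] [Module K A] (mul : A →ₗ[K] A →ₗ[K] A)
  {I J : Type} [Finite I] [Finite J]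

/-- The action of the free operad on an algebra. -/
noncomputable def eval (v : I → A) : (Mag K).carrier I →ₗ[K] A :=
  Finsupp.linearCombination K fun t : MultilinearWord I => evalWord mul v t.1

@[simp] theorem eval_word (v : I → A) (t : MultilinearWord I) :
    eval mul v (word t) = evalWord mul v t.1 :=
  (Finsupp.linearCombination_single K 1 t).trans (one_smul _ _)

theorem eval_relabel (e : I ≃ J) (v : J → A) (a : (Mag K).carrier I) :
    eval mul v ((Mag K).relabel e a) = eval mul (fun i => v (e i)) a := by
  refine LinearMap.congr_fun (f := eval mul v ∘ₗ (Mag K).relabel e) (hom_ext fun t => ?_) a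
  simp only [LinearMap.comp_apply, relabel_word, eval_word]
  exact evalWord_map mul e v t.1

open Classical in
theorem exists_eval_update_eq (v : I → A) (i : I) (a : (Mag K).carrier I) :
    ∃ F : A →ₗ[K] A, ∀ x, eval mul (Function.update v i x) a = F x := by
  have ha : a ∈ Submodule.span K (Set.range word) := span_range_word (K := K) I ▸ trivial
  induction ha using Submodule.span_induction with
  | mem a ha =>
    obtain ⟨t, rfl⟩ := ha
    simpa using exists_evalWord_update_eq mul v i t.1 t.2.1 (t.2.2 i)
  | zero => exact ⟨0, by simp⟩
  | add a b _ _ ha hb =>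
    obtain ⟨F, hF⟩ := ha
    obtain ⟨G, hG⟩ := hb
    exact ⟨F + G, by simp [hF, hG]⟩
  | smul c a _ ha =>
    obtain ⟨F, hF⟩ := ha
    exact ⟨c • F, by simp [hF]⟩

open Classical in
/-- Letters for the evaluation of a partial composition. -/
noncomputable def plug (i : I) (v : Graft I i J → A) (x : A) (k : I) : A :=
  if h : k = i then x else v (Sum.inl ⟨k, h⟩)

omit [AddCommGroup A] [Finite I] [Finite J] in
open Classical in
theorem update_plug (i : I) (v : Graft I i J → A) (x y : A) :
    Function.update (plug i v x) i y = plug i v y := by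
  funext k
  by_cases h : k = i
  · subst h; simp [plug]
  · simp [plug, h]

/-- Both sides are linear in `b`, because each word of `a` contains `i` once; so it suffices to
substitute words. -/
theorem eval_comp (i : I) (v : Graft I i J → A) (a : (Mag K).carrier I)
    (b : (Mag K).carrier J) :
    eval mul v ((Mag K).comp i a b) =
      eval mul (plug i v (eval mul (fun j => v (Sum.inr j)) b)) a := by
  classical
  have key : ∀ t, eval mul v ((Mag K).comp i (word t) b) =
      eval mul (plug i v (eval mul (fun j => v (Sum.inr j)) b)) (word t) := by
    intro t
    obtain ⟨F, hF⟩ := exists_eval_update_eq mul (plug i v 0) i (word t)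
    simp only [update_plug] at hF
    rw [hF]
    refine LinearMap.congr_fun (f := eval mul v ∘ₗ (Mag K).comp i (word t))
      (g := F ∘ₗ eval mul (fun j => v (Sum.inr j))) (hom_ext fun s => ?_) b
    simp only [LinearMap.comp_apply, comp_word, eval_word, ← hF]
    simp only [MultilinearWord.subst, evalWord_lift]
    congr 1
    funext k
    by_cases h : k = i
    · simp [plug, h, MultilinearWord.substLetter, evalWord_map]
    · simp [plug, h, MultilinearWord.substLetter]
  exact LinearMap.congr_fun (f := eval mul v ∘ₗ ((Mag K).comp i).flip b)
    (hom_ext fun t => by simpa using key t) a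

/-- The ideal of identities of an algebra. -/
noncomputable def identities : SymmOperad.OperadIdeal (Mag K) where
  carrier I _ := ⨅ v : I → A, LinearMap.ker (eval mul v)
  relabel_mem e a ha := by
    simp only [Submodule.mem_iInf, LinearMap.mem_ker] at ha ⊢
    exact fun v => (eval_relabel mul e v a).trans (ha _)
  comp_mem_left i a b ha := by
    simp only [Submodule.mem_iInf, LinearMap.mem_ker] at ha ⊢
    exact fun v => (eval_comp mul i v a b).trans (ha _)
  comp_mem_right {I J} _ _ i a b hb := by
    classical
    simp only [Submodule.mem_iInf, LinearMap.mem_ker] at hb ⊢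
    intro v
    -- The value of `a` is linear in the argument at `i`, and that argument is the value of `b`,
    -- which is zero.
    obtain ⟨F, hF⟩ := exists_eval_update_eq mul (plug i v 0) i a
    rw [eval_comp, hb, ← update_plug i v 0, hF, map_zero]

theorem mem_identities {a : (Mag K).carrier I} :
    a ∈ (identities mul).carrier I ↔ ∀ v, eval mul v a = 0 := by
  simp [identities, Submodule.mem_iInf]

theorem span_le_identities {R : Set ((Mag K).carrier (Fin 3))}
    (hR : ∀ r ∈ R, ∀ v, eval mul v r = 0) :
    (SymmOperad.OperadIdeal.span (Mag K) R).carrier I ≤ (identities mul).carrier I :=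
  iInf₂_le (identities mul) fun r hr => (mem_identities mul).2 (hR r hr)

end eval

end Mag

namespace SymmOperad.OperadIdeal

variable {K : Type u} [Field K] {P : SymmOperad K}

theorem subset_span (R : Set (P.carrier (Fin 3))) : R ⊆ (span P R).carrier (Fin 3) := by
  intro r hr
  change r ∈ (⨅ (N : OperadIdeal P) (_ : R ⊆ N.carrier (Fin 3)), N.carrier (Fin 3))
  simp only [Submodule.mem_iInf]
  exact fun N hN => hN hr

end SymmOperad.OperadIdeal

/-! ### Evaluation of quotients of the free operad. -/

namespace Mag

open FreeMagma SymmOperad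

variable {K : Type u} [Field K]

section quotient

variable {N : OperadIdeal (Mag K)} {A : Type*} [AddCommGroup A] [Module K A]
  {mul : A →ₗ[K] A →ₗ[K] A} {I J : Type} [Finite I] [Finite J]

/-- The action on an algebra of a quotient of the free operad by identities of the algebra. -/
noncomputable def evalQuotient
    (hN : ∀ (I : Type) [Finite I], N.carrier I ≤ (identities mul).carrier I) (v : I → A) :
    N.quotient.carrier I →ₗ[K] A :=
  Submodule.liftQ (N.carrier I) (eval mul v) fun _ ha => (mem_identities mul).1 (hN I ha) v

/-- The projection from the free operad to a quotient. -/
noncomputable def mk (N : OperadIdeal (Mag K)) (I : Type) [Finite I] :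
    (Mag K).carrier I →ₗ[K] N.quotient.carrier I := (N.carrier I).mkQ

theorem mk_surjective (N : OperadIdeal (Mag K)) (I : Type) [Finite I] :
    Function.Surjective (mk N I) := Submodule.mkQ_surjective _

theorem mk_eq_zero {a : (Mag K).carrier I} : mk N I a = 0 ↔ a ∈ N.carrier I :=
  Submodule.Quotient.mk_eq_zero _

variable (hN : ∀ (I : Type) [Finite I], N.carrier I ≤ (identities mul).carrier I)

@[simp] theorem evalQuotient_mk (v : I → A) (a : (Mag K).carrier I) :
    evalQuotient hN v (mk N I a) = eval mul v a := rfl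

theorem evalQuotient_relabel (e : I ≃ J) (v : J → A) (a : N.quotient.carrier I) :
    evalQuotient hN v (N.quotient.relabel e a) = evalQuotient hN (fun i => v (e i)) a := by
  obtain ⟨a, rfl⟩ := mk_surjective N I a
  exact eval_relabel mul e v a

theorem evalQuotient_comp (i : I) (v : Graft I i J → A) (a : N.quotient.carrier I)
    (b : N.quotient.carrier J) :
    evalQuotient hN v (N.quotient.comp i a b) =
      evalQuotient hN (plug i v (evalQuotient hN (fun j => v (Sum.inr j)) b)) a := by
  obtain ⟨a, rfl⟩ := mk_surjective N I a
  obtain ⟨b, rfl⟩ := mk_surjective N J b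
  exact eval_comp mul i v a b

end quotient

end Mag

/-! ### A generic algebra over a quotient of the free operad -/

namespace Mag

open FreeMagma SymmOperad

variable (K : Type u) [Field K]

/-- The multiplication of the free nonassociative algebra. -/
noncomputable def freeMul (X : Type) :
    (FreeMagma X →₀ K) →ₗ[K] (FreeMagma X →₀ K) →ₗ[K] (FreeMagma X →₀ K) :=
  Finsupp.linearCombination K fun t => Finsupp.lmapDomain K K (t * ·)

variable {K}

theorem evalWord_freeMul {X J : Type} (f : J → FreeMagma X) (t : FreeMagma J) :
    evalWord (freeMul K X) (fun j => Finsupp.single (f j) 1) t =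
      Finsupp.single (FreeMagma.lift f t) 1 := by
  induction t using FreeMagma.recOnMul with
  | ih1 i => simp
  | ih2 s t hs ht => rw [evalWord_mul, hs, ht]; simp [freeMul]

/-- The word `x₀ x₁`. -/
def binaryWord : MultilinearWord (Fin 2) :=
  ⟨FreeMagma.of 0 * FreeMagma.of 1, by
    change [0, 1].Nodup ∧ ∀ i : Fin 2, i ∈ [0, 1]; decide⟩

/-- A word with repeated letters is a multilinear word in its own positions, followed by an
identification of letters. In this form it can be composed into an operation. -/
theorem exists_map_eq {X : Type} (s : FreeMagma X) :
    ∃ (J : Type) (_ : Finite J) (t : MultilinearWord J) (f : J → X),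
      FreeMagma.map f t.1 = s := by
  induction s using FreeMagma.recOnMul with
  | ih1 x => exact ⟨Unit, inferInstance, MultilinearWord.unit, fun _ => x, rfl⟩
  | ih2 a b ha hb =>
    obtain ⟨J, _, t, f, rfl⟩ := ha
    obtain ⟨L, _, r, g, rfl⟩ := hb
    refine ⟨J ⊕ L, inferInstance,
      ⟨FreeMagma.map Sum.inl t.1 * FreeMagma.map Sum.inr r.1, ?_⟩, Sum.elim f g, ?_⟩
    · rw [MultilinearWord.letters_mul, MultilinearWord.letters_map, MultilinearWord.letters_map]
      constructor
      · rw [List.nodup_append]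
        refine ⟨t.2.1.map Sum.inl_injective, r.2.1.map Sum.inr_injective, ?_⟩
        simp
      · rintro (j | l)
        · simpa using t.2.2 j
        · simpa using r.2.2 l
    · simp only [map_mul, MultilinearWord.map_map, Sum.elim_inl, Sum.elim_inr]

variable (N : OperadIdeal (Mag K))

/-- The ideal of the free algebra on `X` formed by the values of the operations in `N`. -/
noncomputable def verbalIdeal (X : Type) : Submodule K (FreeMagma X →₀ K) :=
  Submodule.span K {x | ∃ (J : Type) (_ : Finite J) (n : (Mag K).carrier J)
    (_ : n ∈ N.carrier J) (v : J → (FreeMagma X →₀ K)), eval (freeMul K X) v n = x}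

theorem eval_mem_verbalIdeal {X J : Type} [Finite J] {n : (Mag K).carrier J}
    (hn : n ∈ N.carrier J) (v : J → (FreeMagma X →₀ K)) :
    eval (freeMul K X) v n ∈ verbalIdeal N X :=
  Submodule.subset_span ⟨J, inferInstance, n, hn, v, rfl⟩

theorem eval_comp_binaryWord_left {A : Type*} [AddCommGroup A] [Module K A]
    (mul : A →ₗ[K] A →ₗ[K] A) {J : Type} [Finite J] (n : (Mag K).carrier J) (v : J → A) (y : A) :
    eval mul (Sum.elim (fun _ => y) v) ((Mag K).comp (0 : Fin 2) (word binaryWord) n) =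
      mul (eval mul v n) y := by
  rw [eval_comp, eval_word]
  simp [binaryWord, plug]

theorem eval_comp_binaryWord_right {A : Type*} [AddCommGroup A] [Module K A]
    (mul : A →ₗ[K] A →ₗ[K] A) {J : Type} [Finite J] (n : (Mag K).carrier J) (v : J → A) (y : A) :
    eval mul (Sum.elim (fun _ => y) v) ((Mag K).comp (1 : Fin 2) (word binaryWord) n) =
      mul y (eval mul v n) := by
  rw [eval_comp, eval_word]
  simp [binaryWord, plug]

/-- A value of `n` multiplied by `y` is a value of the composite of the binary operation with `n`,
which is again in `N`. -/
theorem freeMul_mem_verbalIdeal_left {X : Type} {x : FreeMagma X →₀ K}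
    (hx : x ∈ verbalIdeal N X) (y : FreeMagma X →₀ K) : freeMul K X x y ∈ verbalIdeal N X := by
  refine (Submodule.span_le (p := (verbalIdeal N X).comap ((freeMul K X).flip y))).2 ?_ hx
  rintro _ ⟨J, _, n, hn, v, rfl⟩
  simp only [SetLike.mem_coe, Submodule.mem_comap, LinearMap.flip_apply]
  rw [← eval_comp_binaryWord_left]
  exact eval_mem_verbalIdeal N (N.comp_mem_right _ _ hn) _

theorem freeMul_mem_verbalIdeal_right {X : Type} (y : FreeMagma X →₀ K) {x : FreeMagma X →₀ K}
    (hx : x ∈ verbalIdeal N X) : freeMul K X y x ∈ verbalIdeal N X := by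
  refine (Submodule.span_le (p := (verbalIdeal N X).comap (freeMul K X y))).2 ?_ hx
  rintro _ ⟨J, _, n, hn, v, rfl⟩
  simp only [SetLike.mem_coe, Submodule.mem_comap]
  rw [← eval_comp_binaryWord_right]
  exact eval_mem_verbalIdeal N (N.comp_mem_right _ _ hn) _

/-- The part of the verbal ideal obtained by evaluating at letters only. -/
noncomputable def letterIdeal (X : Type) : Submodule K (FreeMagma X →₀ K) :=
  Submodule.span K {x | ∃ (J : Type) (_ : Finite J) (n : (Mag K).carrier J)
    (_ : n ∈ N.carrier J) (f : J → X),
      eval (freeMul K X) (fun j => Finsupp.single (FreeMagma.of (f j)) 1) n = x}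

/-- Induction on the number of arguments that are not letters. By linearity such an argument may be
assumed to be a word; composing this word into `n` gives an element of the ideal with fewer
non-letter arguments. -/
theorem eval_mem_letterIdeal {X : Type} (k : ℕ) {J : Type} [Finite J] {n : (Mag K).carrier J}
    (hn : n ∈ N.carrier J) (v : J → (FreeMagma X →₀ K))
    (hk : {j | ∀ x, v j ≠ Finsupp.single (FreeMagma.of x) 1}.ncard ≤ k) :
    eval (freeMul K X) v n ∈ letterIdeal N X := by
  classical
  induction k generalizing J with
  | zero =>
    have h : ∀ j, ∃ x, v j = Finsupp.single (FreeMagma.of x) 1 := by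
      intro j
      by_contra! hj
      rw [Nat.le_zero, Set.ncard_eq_zero (Set.toFinite _)] at hk
      exact (hk ▸ hj : j ∈ (∅ : Set J))
    choose f hf using h
    obtain rfl : v = fun j => Finsupp.single (FreeMagma.of (f j)) 1 := funext hf
    exact Submodule.subset_span ⟨J, inferInstance, n, hn, f, rfl⟩
  | succ k ih =>
    by_cases h : ∃ j, ∀ x, v j ≠ Finsupp.single (FreeMagma.of x) 1
    swap
    · refine ih hn v (le_trans (le_of_eq ?_) (Nat.zero_le k))
      rw [Set.ncard_eq_zero (Set.toFinite _), Set.eq_empty_iff_forall_notMem]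
      exact fun j hj => h ⟨j, hj⟩
    obtain ⟨j, hj⟩ := h
    obtain ⟨F, hF⟩ := exists_eval_update_eq (freeMul K X) v j n
    suffices H : ∀ s, F (Finsupp.single s 1) ∈ letterIdeal N X by
      have : ∀ x, F x ∈ letterIdeal N X := by
        intro x
        induction x using Finsupp.induction_linear with
        | zero => simp
        | add x y hx hy => simpa using add_mem hx hy
        | single s c =>
          rw [← mul_one c, ← smul_eq_mul, ← Finsupp.smul_single, map_smul]
          exact Submodule.smul_mem _ _ (H s)
      simpa [← hF] using this (v j)
    intro s
    obtain ⟨L, _, t, g, rfl⟩ := exists_map_eq s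
    have key := ih (N.comp_mem_left j (word t) hn)
      (Sum.elim (fun k => v k.1) fun l => Finsupp.single (FreeMagma.of (g l)) 1) ?_
    · rw [eval_comp, eval_word] at key
      simp only [Sum.elim_inr] at key
      rw [evalWord_freeMul, MultilinearWord.lift_of] at key
      rw [← hF]
      convert key using 2
      congr 1
      funext k
      by_cases hk : k = j
      · subst hk; simp [plug]
      · simp [plug, hk]
    · have h1 : {k : Graft J j L | ∀ x, Sum.elim (fun k => v k.1)
          (fun l => Finsupp.single (FreeMagma.of (g l)) (1 : K)) k ≠
            Finsupp.single (FreeMagma.of x) 1} =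
          Sum.inl '' {k : {k // k ≠ j} | ∀ x, v k.1 ≠ Finsupp.single (FreeMagma.of x) 1} := by
        ext (k | l)
        · simp
        · simpa using ⟨g l, rfl⟩
      have h2 : Subtype.val '' {k : {k // k ≠ j} | ∀ x, v k.1 ≠
          Finsupp.single (FreeMagma.of x) 1} ⊆
          {j | ∀ x, v j ≠ Finsupp.single (FreeMagma.of x) 1} \ {j} := by
        rintro _ ⟨k, hk, rfl⟩
        exact ⟨hk, k.2⟩
      rw [h1, Set.ncard_image_of_injective _ Sum.inl_injective,
        ← Set.ncard_image_of_injective _ Subtype.val_injective]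
      have h3 := Set.ncard_le_ncard h2 (Set.toFinite _)
      have h4 := Set.ncard_sdiff_singleton_lt_of_mem (s := {j | ∀ x, v j ≠
          Finsupp.single (FreeMagma.of x) 1}) hj (Set.toFinite _)
      omega

open Classical in
/-- The projection of the free algebra to its multilinear part. -/
noncomputable def multilinearPart (I : Type) [Finite I] :
    (FreeMagma I →₀ K) →ₗ[K] (Mag K).carrier I :=
  Finsupp.linearCombination K fun t =>
    if h : t.letters.Nodup ∧ ∀ i, i ∈ t.letters then word ⟨t, h⟩ else 0

theorem multilinearPart_single {I : Type} [Finite I] (t : MultilinearWord I) :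
    multilinearPart (K := K) I (Finsupp.single t.1 1) = word t := by
  rw [multilinearPart, Finsupp.linearCombination_single, one_smul, dif_pos t.2]
  rfl

/-- Evaluation at letters `f` is a relabelling if `f` is bijective. Otherwise every resulting word
repeats or misses a letter and has no multilinear part. -/
theorem multilinearPart_mem {I : Type} [Finite I] {x : FreeMagma I →₀ K}
    (hx : x ∈ letterIdeal N I) : multilinearPart I x ∈ N.carrier I := by
  refine (Submodule.span_le (p := (N.carrier I).comap (multilinearPart I))).2 ?_ hx
  rintro _ ⟨J, _, n, hn, f, rfl⟩
  simp only [SetLike.mem_coe, Submodule.mem_comap]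
  by_cases hf : Function.Bijective f
  · have : multilinearPart I ∘ₗ eval (freeMul K I)
        (fun j => Finsupp.single (FreeMagma.of (f j)) 1) =
          (Mag K).relabel (Equiv.ofBijective f hf) := by
      refine hom_ext fun t => ?_
      rw [LinearMap.comp_apply, eval_word, evalWord_freeMul, relabel_word]
      exact multilinearPart_single (MultilinearWord.relabel (Equiv.ofBijective f hf) t)
    rw [← LinearMap.comp_apply, this]
    exact N.relabel_mem _ hn
  · have : multilinearPart I ∘ₗ eval (freeMul K I)
        (fun j => Finsupp.single (FreeMagma.of (f j)) 1) = 0 := by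
      refine hom_ext fun t => ?_
      rw [LinearMap.comp_apply, eval_word, evalWord_freeMul, MultilinearWord.lift_of,
        multilinearPart, Finsupp.linearCombination_single, one_smul, dif_neg,
        LinearMap.zero_apply]
      rw [MultilinearWord.letters_map]
      rintro ⟨h1, h2⟩
      refine hf ⟨fun a b hab => ?_, fun i => ?_⟩
      · exact List.inj_on_of_nodup_map h1 (t.2.2 a) (t.2.2 b) hab
      · obtain ⟨j, -, hj⟩ := List.mem_map.1 (h2 i)
        exact ⟨j, hj⟩
    rw [← LinearMap.comp_apply, this]
    exact zero_mem _

/-- The multiplication of the relatively free algebra. -/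
noncomputable def relFreeMul (X : Type) :
    ((FreeMagma X →₀ K) ⧸ verbalIdeal N X) →ₗ[K] ((FreeMagma X →₀ K) ⧸ verbalIdeal N X) →ₗ[K]
      ((FreeMagma X →₀ K) ⧸ verbalIdeal N X) :=
  Submodule.liftQ _
    (LinearMap.flip (Submodule.liftQ _
      (LinearMap.flip ((freeMul K X).compr₂ (verbalIdeal N X).mkQ))
      fun b hb => LinearMap.mem_ker.2 (LinearMap.ext fun a =>
        (Submodule.Quotient.mk_eq_zero _).2 (freeMul_mem_verbalIdeal_right N a hb))))
    fun a ha => by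
      refine LinearMap.mem_ker.2 (LinearMap.ext fun b => ?_)
      obtain ⟨b, rfl⟩ := Submodule.Quotient.mk_surjective _ b
      exact (Submodule.Quotient.mk_eq_zero _).2 (freeMul_mem_verbalIdeal_left N ha b)

theorem eval_relFreeMul {X J : Type} [Finite J] (v : J → (FreeMagma X →₀ K))
    (a : (Mag K).carrier J) :
    eval (relFreeMul N X) (fun j => (verbalIdeal N X).mkQ (v j)) a =
      (verbalIdeal N X).mkQ (eval (freeMul K X) v a) := by
  refine LinearMap.congr_fun (g := (verbalIdeal N X).mkQ ∘ₗ eval (freeMul K X) v)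
    (hom_ext fun t => ?_) a
  rw [LinearMap.comp_apply, eval_word, eval_word]
  obtain ⟨t, ht⟩ := t
  simp only
  clear ht
  induction t using FreeMagma.recOnMul with
  | ih1 i => rfl
  | ih2 s t hs ht =>
    rw [evalWord_mul, evalWord_mul, hs, ht]
    rfl

/-- An operadic ideal consists of the identities of an algebra, and membership in it is detected by
the evaluation at one family of elements. -/
theorem exists_generic_algebra (I : Type) [Finite I] :
    ∃ (A : Type u) (_ : AddCommGroup A) (_ : Module K A) (mul : A →ₗ[K] A →ₗ[K] A) (v : I → A),
      (∀ (J : Type) [Finite J], N.carrier J ≤ (identities mul).carrier J) ∧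
        ∀ a : (Mag K).carrier I, eval mul v a = 0 → a ∈ N.carrier I := by
  refine ⟨_, _, _, relFreeMul N I,
    fun i => (verbalIdeal N I).mkQ (Finsupp.single (FreeMagma.of i) 1), ?_, ?_⟩
  · intro J _ n hn
    refine (mem_identities _).2 fun w => ?_
    choose v hv using fun j => Submodule.mkQ_surjective (verbalIdeal N I) (w j)
    obtain rfl : (fun j => (verbalIdeal N I).mkQ (v j)) = w := funext hv
    rw [eval_relFreeMul]
    exact (Submodule.Quotient.mk_eq_zero _).2 (eval_mem_verbalIdeal N hn v)
  · intro a ha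
    rw [eval_relFreeMul] at ha
    have h1 := (Submodule.Quotient.mk_eq_zero _).1 ha
    -- The generic letters detect membership: the verbal ideal is spanned by evaluations at letters,
    -- whose multilinear parts are in `N`.
    have h2 : verbalIdeal N I ≤ letterIdeal N I := by
      refine Submodule.span_le.2 ?_
      rintro _ ⟨J, _, n, hn, v, rfl⟩
      exact eval_mem_letterIdeal N _ hn v le_rfl
    have h3 : multilinearPart I ∘ₗ eval (freeMul K I)
        (fun i => Finsupp.single (FreeMagma.of i) 1) = LinearMap.id := by
      refine hom_ext fun t => ?_
      rw [LinearMap.comp_apply, eval_word, evalWord_freeMul]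
      have h4 : FreeMagma.lift FreeMagma.of t.1 = t.1 :=
        congrArg Subtype.val (MultilinearWord.relabel_refl t)
      rw [h4, multilinearPart_single]
      rfl
    have h5 := multilinearPart_mem N (h2 h1)
    rwa [← LinearMap.comp_apply, h3] at h5

/-- If the values of the multilinear words in every algebra satisfying the identities `N` lie in
the span of at most `d` elements, then the quotient by `N` has dimension at most `d`. -/
theorem finrank_quotient_le {I : Type} [Finite I] {d : ℕ}
    (h : ∀ (A : Type u) [AddCommGroup A] [Module K A] (mul : A →ₗ[K] A →ₗ[K] A) (v : I → A),
      (∀ (J : Type) [Finite J], N.carrier J ≤ (identities mul).carrier J) →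
        ∃ s : Finset A, s.card ≤ d ∧
          ∀ t : MultilinearWord I, evalWord mul v t.1 ∈ Submodule.span K (s : Set A)) :
    Module.Finite K (N.quotient.carrier I) ∧ Module.finrank K (N.quotient.carrier I) ≤ d := by
  obtain ⟨A, _, _, mul, v, hN, hv⟩ := exists_generic_algebra N I
  obtain ⟨s, hs, hsp⟩ := h A mul v hN
  let S := Submodule.span K (s : Set A)
  have hmem : ∀ a, evalQuotient hN v a ∈ S := by
    intro a
    obtain ⟨a, rfl⟩ := mk_surjective N I a
    have ha : a ∈ Submodule.span K (Set.range word) := span_range_word (K := K) I ▸ trivial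
    refine (Submodule.span_le (p := S.comap (evalQuotient hN v ∘ₗ mk N I))).2 ?_ ha
    rintro _ ⟨t, rfl⟩
    simpa using hsp t
  -- The generic evaluation embeds the quotient into the span of `s`.
  have hinj : Function.Injective ((evalQuotient hN v).codRestrict S hmem) := by
    rw [← LinearMap.ker_eq_bot, LinearMap.ker_codRestrict, LinearMap.ker_eq_bot']
    intro a ha
    obtain ⟨a, rfl⟩ := mk_surjective N I a
    exact mk_eq_zero.2 (hv a ha)
  have : Module.Finite K S := Module.Finite.span_of_finite K s.finite_toSet
  exact ⟨Module.Finite.of_injective _ hinj, (LinearMap.finrank_le_finrank_of_injective hinj).trans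
    ((finrank_span_finset_le_card s).trans hs)⟩

end Mag

/-! ### Novikov algebras -/

/-- The identities of Novikov algebras. -/
structure IsNovikov {K A : Type*} [Field K] [AddCommGroup A] [Module K A]
    (mul : A →ₗ[K] A →ₗ[K] A) : Prop where
  left_symm : ∀ a b c, mul (mul a b) c - mul a (mul b c) = mul (mul b a) c - mul b (mul a c)
  right_comm : ∀ a b c, mul (mul a b) c = mul (mul a c) b

namespace Novikov

variable {K A : Type*} [Field K] [AddCommGroup A] [Module K A] (mul : A →ₗ[K] A →ₗ[K] A)

/-- The action of left multiplication by `p` on functions of several variables: the commutator of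
left multiplication with the derivation that it induces on the arguments. -/
def act (p : A) : (List A → A) → List A → A
  | f, [] => mul p (f [])
  | f, z :: Z => act p (fun Y => f (z :: Y)) Z - f (mul p z :: Z)

/-- A function of several variables that is additive in each of them. -/
def MultiAdd (f : List A → A) : Prop :=
  ∀ l₁ a b l₂, f (l₁ ++ (a + b) :: l₂) = f (l₁ ++ a :: l₂) + f (l₁ ++ b :: l₂)

/-- A symmetric function of several variables. -/
def Symm (f : List A → A) : Prop := ∀ l l' : List A, l.Perm l' → f l = f l'

variable {mul}

omit [AddCommGroup A] in
theorem Symm.cons {f : List A → A} (hf : Symm f) (z : A) : Symm fun Y => f (z :: Y) :=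
  fun _ _ h => hf _ _ (h.cons z)

theorem MultiAdd.cons {f : List A → A} (hf : MultiAdd f) (z : A) :
    MultiAdd fun Y => f (z :: Y) :=
  fun l₁ a b l₂ => hf (z :: l₁) a b l₂

theorem act_congr (p : A) (f g : List A → A) (Z : List A)
    (h : ∀ Y : List A, Y.length = Z.length → f Y = g Y) : act mul p f Z = act mul p g Z := by
  induction Z generalizing f g with
  | nil => rw [act, act, h [] rfl]
  | cons z Z ih =>
    rw [act, act, ih _ _ fun Y hY => h (z :: Y) (by simp [hY]), h _ (by simp)]

theorem act_sub (p : A) (f g : List A → A) (Z : List A) :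
    act mul p (fun Y => f Y - g Y) Z = act mul p f Z - act mul p g Z := by
  induction Z generalizing f g with
  | nil => simp [act]
  | cons z Z ih =>
    simp only [act, ih]
    abel

theorem act_add (p : A) (f g : List A → A) (Z : List A) :
    act mul p (fun Y => f Y + g Y) Z = act mul p f Z + act mul p g Z := by
  induction Z generalizing f g with
  | nil => simp [act]
  | cons z Z ih =>
    simp only [act, ih]
    abel

theorem act_add_left (p q : A) {f : List A → A} (hf : MultiAdd f) (Z : List A) :
    act mul (p + q) f Z = act mul p f Z + act mul q f Z := by
  induction Z generalizing f with
  | nil => simp [act]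
  | cons z Z ih =>
    have := hf [] (mul p z) (mul q z) Z
    simp only [List.nil_append] at this
    simp only [act, ih (hf.cons z), map_add, LinearMap.add_apply, this]
    abel

theorem MultiAdd.act {f : List A → A} (hf : MultiAdd f) (p : A) :
    MultiAdd (Novikov.act mul p f) := by
  intro l₁ a b l₂
  induction l₁ generalizing f with
  | nil =>
    have h1 := hf [] (mul p a) (mul p b) l₂
    have h2 : (fun Y => f ((a + b) :: Y)) = fun Y => f (a :: Y) + f (b :: Y) :=
      funext fun Y => hf [] a b Y
    simp only [List.nil_append] at h1
    simp only [List.nil_append, Novikov.act, map_add, h1, h2, act_add]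
    abel
  | cons z l₁ ih =>
    have h1 := hf (mul p z :: l₁) a b l₂
    simp only [List.cons_append] at h1
    simp only [List.cons_append, Novikov.act, h1, ih (hf.cons z)]
    abel

theorem Symm.act {f : List A → A} (hf : Symm f) (p : A) : Symm (Novikov.act mul p f) := by
  intro l l' h
  induction h generalizing f with
  | nil => rfl
  | cons z h ih => rw [Novikov.act, Novikov.act, ih (hf.cons z), hf _ _ (h.cons _)]
  | swap z w Z =>
    have h1 : (fun Y => f (w :: z :: Y)) = fun Y => f (z :: w :: Y) :=
      funext fun Y => hf _ _ (List.Perm.swap z w Y)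
    simp only [Novikov.act, h1, hf _ _ (List.Perm.swap w (mul p z) Z),
      hf _ _ (List.Perm.swap (mul p w) z Z)]
    abel
  | trans _ _ ih1 ih2 => exact (ih1 hf).trans (ih2 hf)

/-- In the model `a d(b)`, if `f` multiplies its arguments by g, then `act p f` multiplies them by p
d(g), and either side here is p w d²(g) times the arguments. The subtracted term cancels p d(w)
d(g). This makes the first two arguments of `higher` interchangeable. -/
theorem act_act_symm (h : IsNovikov mul) (p w : A) {f : List A → A} (hf : MultiAdd f)
    (Z : List A) :
    act mul p (act mul w f) Z - act mul (mul p w) f Z =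
      act mul w (act mul p f) Z - act mul (mul w p) f Z := by
  induction Z generalizing f with
  | nil =>
    simp only [act]
    have := h.left_symm p w (f [])
    rw [← neg_inj, neg_sub, neg_sub]
    exact this
  | cons z Z ih =>
    have ih := ih (hf.cons z)
    simp only [act, act_sub]
    have h1 := hf [] (mul w (mul p z)) (mul (mul p w) z) Z
    have h2 := hf [] (mul p (mul w z)) (mul (mul w p) z) Z
    simp only [List.nil_append] at h1 h2
    have h3 : mul w (mul p z) + mul (mul p w) z = mul p (mul w z) + mul (mul w p) z := by
      have := h.left_symm p w z
      rw [sub_eq_sub_iff_add_eq_add] at this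
      rw [add_comm, this, add_comm]
    rw [h3, h2] at h1
    linear_combination (norm := module) ih - h1

variable (mul) in
/-- `higher mul y n [z₁, …, zₙ]` is the analogue of `z₁ ⋯ zₙ d^n(y)`. -/
def higher (y : A) : ℕ → List A → A
  | 0, [] => y
  | 0, _ :: _ => 0
  | _ + 1, [] => 0
  | n + 1, p :: Z => act mul p (higher y n) Z

theorem multiAdd_higher (y : A) (n : ℕ) : MultiAdd (higher mul y n) := by
  induction n with
  | zero =>
    intro l₁ a b l₂
    cases l₁ <;> simp [higher]
  | succ n ih =>
    intro l₁ a b l₂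
    cases l₁ with
    | nil => exact act_add_left a b ih l₂
    | cons z l₁ => exact ih.act z l₁ a b l₂

theorem act_zero (p : A) (Z : List A) : act mul p (fun _ => 0) Z = 0 := by
  induction Z with
  | nil => simp [act]
  | cons z Z ih => simp [act, ih]

theorem symm_higher (h : IsNovikov mul) (y : A) (n : ℕ) : Symm (higher mul y n) := by
  induction n with
  | zero =>
    intro l l' hl
    cases l with
    | nil => rw [hl.nil_eq]
    | cons z l =>
      cases l' with
      | nil => exact absurd hl.eq_nil (List.cons_ne_nil _ _)
      | cons z' l' => rfl
  | succ n ih =>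
    intro l l' hl
    induction hl with
    | nil => rfl
    | cons z hl _ => exact ih.act z _ _ hl
    | swap z w Z =>
      change act mul w (higher mul y n) (z :: Z) = act mul z (higher mul y n) (w :: Z)
      cases n with
      -- Here the list is longer than the order, and both sides are the default value 0.
      | zero =>
        simp only [act, higher, act_zero]
      | succ n => exact act_act_symm h w z (multiAdd_higher y n) Z
    | trans _ _ ih1 ih2 => exact ih1.trans ih2

/-- Additive operators that commute with right multiplications. -/
structure RightLinear (mul : A →ₗ[K] A →ₗ[K] A) (T : A → A) : Prop where
  add : ∀ x y, T (x + y) = T x + T y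
  mul : ∀ x y, T (mul x y) = mul (T x) y

theorem RightLinear.sub {T : A → A} (hT : RightLinear mul T) (x y : A) :
    T (x - y) = T x - T y :=
  map_sub (AddMonoidHom.mk' T hT.add) x y

theorem RightLinear.zero {T : A → A} (hT : RightLinear mul T) : T 0 = 0 :=
  map_zero (AddMonoidHom.mk' T hT.add)

theorem rightLinear_mul (h : IsNovikov mul) (b : A) : RightLinear mul fun x => mul x b :=
  ⟨fun x y => by simp, fun x y => h.right_comm x y b⟩

/-- In `mul (T q) x` the operator comes out because it commutes with right multiplications. In the
other terms it sits in an argument of `f`; symmetry brings that argument to the head, where `hfT`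
applies. -/
theorem act_rightLinear {T : A → A} (hT : RightLinear mul T) {f : List A → A} (hf : Symm f)
    (hfT : ∀ x Y, f (T x :: Y) = T (f (x :: Y))) (q : A) (Z : List A) :
    act mul (T q) f Z = T (act mul q f Z) := by
  induction Z generalizing f with
  | nil => exact (hT.mul _ _).symm
  | cons z Z ih =>
    rw [act, act, hT.sub, ← hT.mul, hfT, ih (hf.cons z)]
    intro x Y
    rw [hf _ _ (List.Perm.swap _ _ _), hfT, hf _ _ (List.Perm.swap _ _ _)]

theorem higher_rightLinear (h : IsNovikov mul) {T : A → A} (hT : RightLinear mul T) (y : A)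
    (n : ℕ) (x : A) (Y : List A) :
    higher mul y n (T x :: Y) = T (higher mul y n (x :: Y)) := by
  induction n generalizing x Y with
  | zero => exact hT.zero.symm
  | succ n ih => exact act_rightLinear hT (symm_higher h y n) ih x Y

variable (mul) in
/-- The analogue of `z₁ ⋯ zₙ d^n(y)`. -/
def brace (y : A) (Z : List A) : A := higher mul y Z.length Z

theorem brace_cons (y p : A) (Z : List A) :
    brace mul y (p :: Z) = act mul p (brace mul y) Z :=
  act_congr p _ _ Z fun Y hY => by rw [brace, hY]

theorem symm_brace (h : IsNovikov mul) (y : A) : Symm (brace mul y) := by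
  intro l l' hl
  rw [brace, brace, hl.length_eq]
  exact symm_higher h y _ _ _ hl

/-- So braces with one free argument are themselves operators that `brace_rightLinear` can pull out.
Hence they commute with each other, which replaces the commutativity of the product in the
differential model. -/
theorem rightLinear_brace (h : IsNovikov mul) (y : A) (Z : List A) :
    RightLinear mul fun p => brace mul y (p :: Z) :=
  ⟨fun a b => multiAdd_higher y _ [] a b Z,
    fun a b => higher_rightLinear h (rightLinear_mul h b) y _ a Z⟩

theorem brace_rightLinear (h : IsNovikov mul) {T : A → A} (hT : RightLinear mul T) (y x : A)
    (Y : List A) : brace mul y (T x :: Y) = T (brace mul y (x :: Y)) :=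
  higher_rightLinear h hT y _ x Y

variable (mul) in
/-- The analogue of the product of the elements of `zs` and of the elements `d^(e + 1)(y)` for
`(y, e)` in the second list, whose length determines the number of elements of `zs` needed. -/
def monomial : List A → List (A × ℕ) → A
  | [x], [] => x
  | _, [] => 0
  | zs, (y, e) :: ys => monomial (brace mul y (zs.take (e + 1)) :: zs.drop (e + 1)) ys

theorem monomial_nil_rightLinear {T : A → A} (hT : RightLinear mul T) (p : A) (U : List A) :
    monomial mul (T p :: U) [] = T (monomial mul (p :: U) []) := by
  cases U with
  | nil => rfl
  | cons => exact hT.zero.symm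

theorem monomial_rightLinear (h : IsNovikov mul) {T : A → A} (hT : RightLinear mul T) (p : A)
    (U : List A) (ys : List (A × ℕ)) :
    monomial mul (T p :: U) ys = T (monomial mul (p :: U) ys) := by
  induction ys generalizing p U with
  | nil => exact monomial_nil_rightLinear hT p U
  | cons q ys ih =>
    obtain ⟨y, e⟩ := q
    simp only [monomial, List.take_succ_cons, List.drop_succ_cons, brace_rightLinear h hT, ih]

theorem rightLinear_monomial (h : IsNovikov mul) (U : List A) (ys : List (A × ℕ)) :
    RightLinear mul fun p => monomial mul (p :: U) ys := by
  induction ys generalizing U with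
  | nil =>
    cases U with
    | nil => exact ⟨fun _ _ => rfl, fun _ _ => rfl⟩
    | cons => exact ⟨fun _ _ => by simp [monomial], fun _ _ => by simp [monomial]⟩
  | cons q ys ih =>
    obtain ⟨y, e⟩ := q
    have h1 := rightLinear_brace h y (U.take e)
    have h2 := ih (U.drop e)
    simp only [monomial, List.take_succ_cons, List.drop_succ_cons]
    exact ⟨fun a b => by rw [h1.add, h2.add], fun a b => by rw [h1.mul, h2.mul]⟩

/-- The one transposition not settled by the symmetry of `f` or by `ih` alone exchanges the last
element fed to `f` with the first one left over. Once the earlier arguments are absorbed into `f`,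
the operator `f [·]` is right linear and comes out of the monomial, and then `ih` applies. -/
theorem monomial_take_perm (h : IsNovikov mul) (ys : List (A × ℕ))
    (ih : ∀ zs zs' : List A, zs.Perm zs' → monomial mul zs ys = monomial mul zs' ys)
    {zs zs' : List A} (hzs : zs.Perm zs') (e : ℕ) {f : List A → A} (hf : Symm f)
    (hfT : ∀ Y, RightLinear mul fun x => f (x :: Y)) :
    monomial mul (f (zs.take (e + 1)) :: zs.drop (e + 1)) ys =
      monomial mul (f (zs'.take (e + 1)) :: zs'.drop (e + 1)) ys := by
  have hcons : ∀ z, ∀ Y, RightLinear mul fun x => f (z :: x :: Y) := fun z Y => by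
    have : (fun x => f (z :: x :: Y)) = fun x => f (x :: z :: Y) :=
      funext fun x => hf _ _ (List.Perm.swap _ _ _)
    rw [this]
    exact hfT _
  induction hzs generalizing e f with
  | nil => rfl
  | cons z hzs ih' =>
    cases e with
    | zero => simpa using ih _ _ (hzs.cons _)
    | succ e =>
      refine ih' e (hf.cons z) (hcons z) fun w Y => ?_
      have : (fun x => f (z :: w :: x :: Y)) = fun x => f (x :: z :: w :: Y) := by
        funext x
        refine hf _ _ ?_
        exact ((List.Perm.swap x w Y).cons z).trans (List.Perm.swap x z _)
      rw [this]
      exact hfT _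
  | swap z w Z =>
    cases e with
    | zero =>
      simp only [zero_add, List.take_succ_cons, List.take_zero, List.drop_succ_cons,
        List.drop_zero]
      rw [monomial_rightLinear h (hfT []), monomial_rightLinear h (hfT []),
        ih _ _ (List.Perm.swap _ _ _)]
    | succ e =>
      simp only [List.take_succ_cons, List.drop_succ_cons, hf _ _ (List.Perm.swap _ _ _)]
  | trans _ _ ih1 ih2 => exact (ih1 e hf hfT hcons).trans (ih2 e hf hfT hcons)

theorem monomial_perm_left (h : IsNovikov mul) (ys : List (A × ℕ)) {zs zs' : List A}
    (hzs : zs.Perm zs') : monomial mul zs ys = monomial mul zs' ys := by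
  induction ys generalizing zs zs' with
  | nil =>
    rcases zs with _ | ⟨a, _ | ⟨b, l⟩⟩
    · rw [hzs.nil_eq]
    · rw [List.singleton_perm.1 hzs]
    · rcases zs' with _ | ⟨a', _ | ⟨b', l'⟩⟩
      · rfl
      · simpa using hzs.length_eq
      · rfl
  | cons q ys ih =>
    obtain ⟨y, e⟩ := q
    simp only [monomial]
    exact monomial_take_perm h ys (fun _ _ => ih) hzs e (symm_brace h y) (rightLinear_brace h y)

/-- The number of factors without derivative in a monomial. -/
def arity {X : Type*} (ys : List (X × ℕ)) : ℕ := 1 + (ys.map Prod.snd).sum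

theorem arity_cons {X : Type*} (y : X) (e : ℕ) (ys : List (X × ℕ)) :
    arity ((y, e) :: ys) = e + arity ys := by
  simp [arity]; omega

/-- Substitution of a monomial for a factor without derivative. The length condition says that `ys₁`
consumes `zs₁` down to a single element. -/
theorem monomial_append (ys₁ ys : List (A × ℕ)) {zs₁ : List A} (zs : List A)
    (hz : zs₁.length = arity ys₁) :
    monomial mul (zs₁ ++ zs) (ys₁ ++ ys) = monomial mul (monomial mul zs₁ ys₁ :: zs) ys := by
  induction ys₁ generalizing zs₁ with
  | nil =>
    obtain ⟨x, rfl⟩ := List.length_eq_one_iff.1 (hz.trans (by simp [arity]))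
    rfl
  | cons q ys₁ ih =>
    obtain ⟨y, e⟩ := q
    rw [arity_cons] at hz
    have h1 : e + 1 ≤ zs₁.length := by rw [hz]; simp [arity]
    rw [List.cons_append, monomial, monomial, List.take_append_of_le_length h1,
      List.drop_append_of_le_length h1, ← List.cons_append, ih]
    simp [hz]
    omega

theorem monomial_append_cons (y : A) (e : ℕ) (ys : List (A × ℕ)) {Z : List A} (U : List A)
    (hZ : Z.length = e + 1) :
    monomial mul (Z ++ U) ((y, e) :: ys) = monomial mul (brace mul y Z :: U) ys := by
  rw [monomial, ← hZ, List.take_left, List.drop_left]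

/-- Both braces act on a common element `p`. The operator `brace y (· :: U₁)` is right linear, so it
comes out of `brace y' (· :: U₂)`. -/
theorem monomial_swap (h : IsNovikov mul) (a b : A × ℕ) (ys : List (A × ℕ)) {zs : List A}
    (hz : zs.length = arity (a :: b :: ys)) :
    monomial mul zs (a :: b :: ys) = monomial mul zs (b :: a :: ys) := by
  obtain ⟨y, e⟩ := a
  obtain ⟨y', e'⟩ := b
  rw [arity_cons, arity_cons] at hz
  obtain ⟨p, U, rfl⟩ : ∃ p U, zs = p :: U := by
    cases zs with
    | nil => simp [arity] at hz; omega
    | cons p U => exact ⟨p, U, rfl⟩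
  obtain ⟨U₁, U₂, V, hU, hU₁, hU₂⟩ : ∃ U₁ U₂ V, U = U₁ ++ (U₂ ++ V) ∧ U₁.length = e ∧
      U₂.length = e' := by
    refine ⟨U.take e, (U.drop e).take e', (U.drop e).drop e', ?_, ?_, ?_⟩
    · rw [List.take_append_drop, List.take_append_drop]
    · simp [arity] at hz ⊢; omega
    · simp [arity] at hz ⊢; omega
  subst hU
  -- After this exchange `y` is paired with `U₁` and `y'` with `U₂` on both sides.
  have h1 : (p :: (U₁ ++ (U₂ ++ V))).Perm (p :: (U₂ ++ (U₁ ++ V))) := by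
    refine List.Perm.cons _ ?_
    rw [← List.append_assoc, ← List.append_assoc]
    exact List.perm_append_comm.append_right V
  have hX : ∀ q : A, (q :: U₁).length = e + 1 := fun q => by simp [hU₁]
  have hY : ∀ q : A, (q :: U₂).length = e' + 1 := fun q => by simp [hU₂]
  rw [monomial_perm_left h ((y', e') :: (y, e) :: ys) h1, ← List.cons_append, ← List.cons_append,
    monomial_append_cons _ _ _ _ (hX _),
    monomial_append_cons _ _ _ _ (hY _),
    ← List.cons_append, ← List.cons_append,
    monomial_append_cons _ _ _ _ (hY _),
    monomial_append_cons _ _ _ _ (hX _),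
    brace_rightLinear h (rightLinear_brace h y U₁)]

theorem monomial_perm_right (h : IsNovikov mul) {ys ys' : List (A × ℕ)} (hys : ys.Perm ys')
    {zs : List A} (hz : zs.length = arity ys) : monomial mul zs ys = monomial mul zs ys' := by
  induction hys generalizing zs with
  | nil => rfl
  | cons q _ ih =>
    obtain ⟨y, e⟩ := q
    rw [arity_cons] at hz
    simp only [monomial]
    refine ih ?_
    simp [arity] at hz ⊢
    omega
  | swap a b ys => exact monomial_swap h _ _ _ hz
  | trans h1 _ ih1 ih2 =>
    refine (ih1 hz).trans (ih2 ?_)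
    rw [hz, arity, arity, (h1.map Prod.snd).sum_eq]

/-- By construction `act p f Z` is `mul p (f Z)` minus the terms in which `p` multiplies one
argument of `f`. -/
theorem mul_apply_mem (p : A) (E : AddSubgroup A) (φ : A →+ A) (f : List A → A) (Z : List A)
    (h1 : φ (act mul p f Z) ∈ E)
    (h2 : ∀ l₁ z l₂, Z = l₁ ++ z :: l₂ → φ (f (l₁ ++ mul p z :: l₂)) ∈ E) :
    φ (mul p (f Z)) ∈ E := by
  induction Z generalizing f with
  | nil => exact h1
  | cons z Z ih =>
    refine ih (fun Y => f (z :: Y)) ?_ fun l₁ w l₂ hZ => h2 (z :: l₁) w l₂ (by rw [hZ]; rfl)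
    rw [act, map_sub] at h1
    have := add_mem h1 (h2 [] z Z rfl)
    simpa using this

/-- The Leibniz rule for `p d(m)`, where `m` is a monomial. -/
theorem mul_monomial_mem (h : IsNovikov mul) (p : A) (E : AddSubgroup A) (ys : List (A × ℕ))
    {zs : List A} (hz : zs.length = arity ys)
    (h1 : ∀ l₁ z l₂, zs = l₁ ++ z :: l₂ → monomial mul (l₁ ++ mul p z :: l₂) ys ∈ E)
    (h2 : ∀ l₁ y e l₂, ys = l₁ ++ (y, e) :: l₂ →
      monomial mul (p :: zs) (l₁ ++ (y, e + 1) :: l₂) ∈ E) :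
    mul p (monomial mul zs ys) ∈ E := by
  induction ys generalizing zs with
  | nil =>
    obtain ⟨x, rfl⟩ := List.length_eq_one_iff.1 (hz.trans (by simp [arity]))
    exact h1 [] x [] rfl
  | cons q ys ih =>
    obtain ⟨y, e⟩ := q
    rw [arity_cons] at hz
    obtain ⟨Z, U, rfl, hZ⟩ : ∃ Z U, zs = Z ++ U ∧ Z.length = e + 1 :=
      ⟨zs.take (e + 1), zs.drop (e + 1), (List.take_append_drop _ _).symm, by
        simp [arity] at hz ⊢; omega⟩
    rw [monomial_append_cons _ _ _ _ hZ]
    refine ih (by simp at hz ⊢; omega) ?_ ?_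
    · intro l₁ z l₂ hl
      rcases l₁ with _ | ⟨b, l₁⟩
      -- The factor hit by p d(·) is the brace formed from `y` and `Z`. The derivative either raises
      -- the order at `y`, with `p` joining `Z`, or falls on an element of `Z`.
      · obtain ⟨rfl, rfl⟩ : brace mul y Z = z ∧ U = l₂ := by simpa using hl
        have hadd := rightLinear_monomial h U ys
        refine mul_apply_mem p E (AddMonoidHom.mk' (fun q => monomial mul (q :: U) ys) hadd.add) (brace mul y) Z ?_ ?_
        · rw [← brace_cons, AddMonoidHom.mk'_apply,
            ← monomial_append_cons y (e + 1) ys U (by simp [hZ])]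
          exact h2 [] y e ys rfl
        · intro l₁ z l₂ hZ'
          rw [AddMonoidHom.mk'_apply, ← monomial_append_cons y e ys U, List.append_assoc,
            List.cons_append]
          · exact h1 l₁ z (l₂ ++ U) (by simp [hZ'])
          · rw [← hZ, hZ']; simp
      · obtain ⟨rfl, rfl⟩ : brace mul y Z = b ∧ U = l₁ ++ z :: l₂ := by simpa using hl
        rw [List.cons_append, ← monomial_append_cons y e ys _ hZ, ← List.append_assoc]
        exact h1 (Z ++ l₁) z l₂ (by simp)
    · intro l₁ y' e' l₂ hl
      have := h2 ((y, e) :: l₁) y' e' l₂ (by rw [hl]; rfl)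
      rw [monomial_perm_left h _ (List.Perm.swap _ _ _),
        ← monomial_append_cons y e _ _ hZ, monomial_perm_left h _ List.perm_middle]
      exact this

end Novikov

/-! ### Novikov words as combinations of monomials in the letters. -/

namespace Novikov

open FreeMagma

variable {K A : Type*} [Field K] [AddCommGroup A] [Module K A] {mul : A →ₗ[K] A →ₗ[K] A}
  {I : Type}

variable (mul) in
/-- The monomial in the letters `v`. -/
def letterMonomial (v : I → A) (zs : List I) (ys : List (I × ℕ)) : A :=
  monomial mul (zs.map v) (ys.map fun q => (v q.1, q.2))

theorem arity_map {X Y : Type*} (v : X → Y) (ys : List (X × ℕ)) :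
    arity (ys.map fun q => (v q.1, q.2)) = arity ys := by
  simp [arity, Function.comp_def]

variable (mul) in
/-- The additive span of the monomials of given content. -/
def monomialSpan (v : I → A) (s : List I) : AddSubgroup A :=
  AddSubgroup.closure {x | ∃ (zs : List I) (ys : List (I × ℕ)), zs.length = arity ys ∧
    (zs ++ ys.map Prod.fst).Perm s ∧ letterMonomial mul v zs ys = x}

theorem letterMonomial_mem (v : I → A) {zs : List I} {ys : List (I × ℕ)} {s : List I}
    (h1 : zs.length = arity ys) (h2 : (zs ++ ys.map Prod.fst).Perm s) :
    letterMonomial mul v zs ys ∈ monomialSpan mul v s :=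
  AddSubgroup.subset_closure ⟨zs, ys, h1, h2, rfl⟩

/-- The terms of the Leibniz rule are again letter monomials: a factor `w` without derivative
becomes the pair `(w, 0)`, a pair `(y, e)` becomes `(y, e + 1)`, and `p` joins the factors without
derivative. -/
theorem mul_letterMonomial_mem (h : IsNovikov mul) (v : I → A) (p : I) {zs : List I}
    {ys : List (I × ℕ)} (hz : zs.length = arity ys) :
    mul (v p) (letterMonomial mul v zs ys) ∈
      monomialSpan mul v (p :: (zs ++ ys.map Prod.fst)) := by
  refine mul_monomial_mem h (v p) _ _ (by rw [List.length_map, arity_map, hz]) ?_ ?_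
  · intro l₁ z l₂ hl
    obtain ⟨m₁, m', rfl, rfl, h'⟩ := List.map_eq_append_iff.1 hl
    obtain ⟨w, m₂, rfl, rfl, rfl⟩ := List.map_eq_cons_iff.1 h'
    have h1 : monomial mul (m₁.map v ++ mul (v p) (v w) :: m₂.map v)
        (ys.map fun q => (v q.1, q.2)) =
          letterMonomial mul v (p :: (m₁ ++ m₂)) ((w, 0) :: ys) := by
      rw [monomial_perm_left h _ List.perm_middle, letterMonomial, List.map_cons, List.map_cons,
        ← List.map_append]
      exact (monomial_append_cons (mul := mul) (v w) 0 _ (Z := [v p]) ((m₁ ++ m₂).map v) rfl).symm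
    rw [h1]
    refine letterMonomial_mem v ?_ ?_
    · rw [arity_cons, ← hz]; simp; omega
    · rw [List.cons_append]
      refine List.Perm.cons _ ?_
      rw [List.map_cons, List.append_assoc, List.append_assoc]
      refine List.Perm.append_left _ ?_
      rw [List.cons_append]
      exact List.perm_middle
  · intro l₁ y e l₂ hl
    obtain ⟨m₁, m', rfl, rfl, h'⟩ := List.map_eq_append_iff.1 hl
    obtain ⟨⟨w, e'⟩, m₂, rfl, h'', rfl⟩ := List.map_eq_cons_iff.1 h'
    obtain ⟨rfl, rfl⟩ := Prod.mk.inj h''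
    have h1 : monomial mul (v p :: zs.map v) (m₁.map (fun q => (v q.1, q.2)) ++
        (v w, e' + 1) :: m₂.map fun q => (v q.1, q.2)) =
          letterMonomial mul v (p :: zs) (m₁ ++ (w, e' + 1) :: m₂) := by
      simp [letterMonomial]
    simp only
    rw [h1]
    refine letterMonomial_mem v ?_ ?_
    · simp [arity] at hz ⊢; omega
    · simp

theorem monomialSpan_perm (v : I → A) {s t : List I} (h : s.Perm t) :
    monomialSpan mul v s = monomialSpan mul v t := by
  have : ∀ {s t : List I}, s.Perm t → monomialSpan mul v s ≤ monomialSpan mul v t := by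
    intro s t h
    refine AddSubgroup.closure_mono ?_
    rintro x ⟨zs, ys, h1, h2, h3⟩
    exact ⟨zs, ys, h1, h2.trans h, h3⟩
  exact le_antisymm (this h) (this h.symm)

/-- Right multiplication by `y` is right linear, so it only affects one factor `p` without
derivative. The product of `p` and `y` is expanded by the Leibniz rule, and each resulting monomial
is substituted for `p`. -/
theorem mul_mem_monomialSpan (h : IsNovikov mul) (v : I → A) {s t : List I} {x y : A}
    (hx : x ∈ monomialSpan mul v s) (hy : y ∈ monomialSpan mul v t) :
    mul x y ∈ monomialSpan mul v (s ++ t) := by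
  suffices H : monomialSpan mul v s ≤
      (monomialSpan mul v (s ++ t)).comap (mul.flip y).toAddMonoidHom from H hx
  refine (AddSubgroup.closure_le _).2 ?_
  rintro _ ⟨zs, ys, h1, h2, rfl⟩
  obtain ⟨p, zs, rfl⟩ : ∃ p zs', zs = p :: zs' := by
    cases zs with
    | nil => simp [arity] at h1; omega
    | cons p zs => exact ⟨p, zs, rfl⟩
  have h3 : mul (letterMonomial mul v (p :: zs) ys) y =
      monomial mul (mul (v p) y :: zs.map v) (ys.map fun q => (v q.1, q.2)) :=
    (monomial_rightLinear h (rightLinear_mul h y) _ _ _).symm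
  change mul (letterMonomial mul v (p :: zs) ys) y ∈ monomialSpan mul v (s ++ t)
  rw [h3]
  have hlin := rightLinear_monomial h (zs.map v) (ys.map fun q => (v q.1, q.2))
  have h4 : mul (v p) y ∈ monomialSpan mul v (p :: t) := by
    suffices H : monomialSpan mul v t ≤
        (monomialSpan mul v (p :: t)).comap (mul (v p)).toAddMonoidHom from H hy
    refine (AddSubgroup.closure_le _).2 ?_
    rintro _ ⟨zs', ys', h1', h2', rfl⟩
    have := mul_letterMonomial_mem h v p h1'
    rwa [monomialSpan_perm v (h2'.cons p)] at this
  suffices H : monomialSpan mul v (p :: t) ≤ (monomialSpan mul v (s ++ t)).comap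
      (AddMonoidHom.mk' (fun q => monomial mul (q :: zs.map v) (ys.map fun q => (v q.1, q.2)))
        hlin.add) from H h4
  refine (AddSubgroup.closure_le _).2 ?_
  rintro _ ⟨zs', ys', h1', h2', rfl⟩
  change monomial mul (letterMonomial mul v zs' ys' :: zs.map v) _ ∈ monomialSpan mul v (s ++ t)
  have h5 : monomial mul (letterMonomial mul v zs' ys' :: zs.map v)
      (ys.map fun q => (v q.1, q.2)) = letterMonomial mul v (zs' ++ zs) (ys' ++ ys) := by
    rw [letterMonomial, letterMonomial, List.map_append, List.map_append, monomial_append]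
    rw [List.length_map, arity_map, h1']
  rw [h5]
  refine letterMonomial_mem v ?_ ?_
  · simp [arity] at h1 h1' ⊢; omega
  · rw [← Multiset.coe_eq_coe] at h2 h2' ⊢
    simp only [← Multiset.coe_add, List.map_append, ← Multiset.cons_coe,
      ← Multiset.singleton_add] at h2 h2' ⊢
    rw [← h2]
    have h6 : (({p} + (zs : Multiset I)) + ((ys.map Prod.fst : List I) : Multiset I)) + t =
      ((zs : Multiset I) + ((ys.map Prod.fst : List I) : Multiset I)) + ({p} + (t : Multiset I)) := by
      abel
    rw [h6, ← h2']
    abel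

theorem evalWord_mem_monomialSpan (h : IsNovikov mul) (v : I → A) (t : FreeMagma I) :
    evalWord mul v t ∈ monomialSpan mul v t.letters := by
  induction t using FreeMagma.recOnMul with
  | ih1 i => exact letterMonomial_mem v (zs := [i]) (ys := []) rfl (List.Perm.refl _)
  | ih2 s t hs ht => exact mul_mem_monomialSpan h v hs ht

variable [Fintype I] [DecidableEq I]

variable (mul) in
/-- The monomial in all the letters with prescribed orders of the derivatives. -/
noncomputable def exponentMonomial (v : I → A) (a : I → ℕ) : A :=
  letterMonomial mul v (Finset.univ.filter fun i => a i = 0).toList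
    ((Finset.univ.filter fun i => a i ≠ 0).toList.map fun i => (i, a i - 1))

/-- The exponent is 0 on `zs` and e + 1 at a pair (i, e). As `zs` has 1 + ∑ e elements, the
exponents add up to the number of letters minus one. By invariance under permutations of both lists,
they determine the monomial. -/
theorem exists_exponentMonomial_eq (h : IsNovikov mul) (v : I → A) {zs : List I}
    {ys : List (I × ℕ)} (hz : zs.length = arity ys) (hn : (zs ++ ys.map Prod.fst).Nodup)
    (hu : ∀ i, i ∈ zs ++ ys.map Prod.fst) :
    ∃ a : I → ℕ, ∑ i, a i = Fintype.card I - 1 ∧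
      exponentMonomial mul v a = letterMonomial mul v zs ys := by
  let a : I → ℕ := fun i => (ys.map fun q => if q.1 = i then q.2 + 1 else 0).sum
  have hcard : zs.length + ys.length = Fintype.card I := by
    have h1 := List.toFinset_card_of_nodup hn
    rw [List.length_append, List.length_map] at h1
    rw [← h1, ← Finset.card_univ]
    congr 1
    ext i
    simpa using hu i
  have hsum : ∑ i, a i = (ys.map fun q => q.2 + 1).sum := by
    simp only [a]
    clear hz hn hu hcard a
    induction ys with
    | nil => simp
    | cons q ys ih => simp [Finset.sum_add_distrib, ih]
  rw [List.nodup_append] at hn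
  obtain ⟨hn1, hn2, hn3⟩ := hn
  have ha : ∀ q ∈ ys, a q.1 = q.2 + 1 := by
    simp only [a]
    clear hz hu hcard hsum a hn3
    induction ys with
    | nil => simp
    | cons r ys ih =>
      rw [List.map_cons, List.nodup_cons] at hn2
      intro q hq
      rw [List.map_cons, List.sum_cons]
      rcases List.mem_cons.1 hq with rfl | hq
      · rw [if_pos rfl, Nat.add_eq_left, List.sum_eq_zero]
        intro x hx
        obtain ⟨r, hr, rfl⟩ := List.mem_map.1 hx
        exact if_neg fun e => hn2.1 (List.mem_map.2 ⟨r, hr, e⟩)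
      · rw [if_neg, zero_add, ih hn2.2 q hq]
        exact fun e => hn2.1 (List.mem_map.2 ⟨q, hq, e.symm⟩)
  have ha0 : ∀ i, i ∉ ys.map Prod.fst → a i = 0 := by
    intro i hi
    refine List.sum_eq_zero ?_
    intro x hx
    obtain ⟨r, hr, rfl⟩ := List.mem_map.1 hx
    exact if_neg fun e => hi (List.mem_map.2 ⟨r, hr, e⟩)
  have ha1 : ∀ i, i ∈ ys.map Prod.fst → a i ≠ 0 := by
    intro i hi
    obtain ⟨r, hr, rfl⟩ := List.mem_map.1 hi
    rw [ha r hr]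
    omega
  have hzs : (Finset.univ.filter fun i => a i = 0).toList.Perm zs := by
    rw [List.perm_ext_iff_of_nodup (Finset.nodup_toList _) hn1]
    intro i
    simp only [Finset.mem_toList, Finset.mem_filter, Finset.mem_univ, true_and]
    constructor
    · intro hi
      exact (List.mem_append.1 (hu i)).resolve_right fun h' => ha1 i h' hi
    · intro hi
      exact ha0 i fun h' => hn3 i hi i h' rfl
  have hys : ((Finset.univ.filter fun i => a i ≠ 0).toList.map fun i => (i, a i - 1)).Perm
      ys := by
    rw [List.perm_ext_iff_of_nodup
      ((Finset.nodup_toList _).map fun i j hij => (Prod.mk.inj hij).1) (List.Nodup.of_map _ hn2)]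
    intro q
    simp only [List.mem_map, Finset.mem_toList, Finset.mem_filter, Finset.mem_univ, true_and]
    constructor
    · rintro ⟨i, hi, rfl⟩
      have : i ∈ ys.map Prod.fst := by
        by_contra h'
        exact hi (ha0 i h')
      obtain ⟨r, hr, rfl⟩ := List.mem_map.1 this
      rw [ha r hr]
      exact hr
    · intro hq
      exact ⟨q.1, ha1 _ (List.mem_map.2 ⟨q, hq, rfl⟩), by rw [ha q hq]; rfl⟩
  refine ⟨a, ?_, ?_⟩
  · rw [hsum, ← hcard, hz, arity]
    simp only [List.sum_map_add, List.map_const', List.sum_replicate, smul_eq_mul, mul_one]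
    omega
  · rw [exponentMonomial, letterMonomial, letterMonomial, monomial_perm_left h _ (hzs.map v)]
    refine (monomial_perm_right h (hys.symm.map _) ?_).symm
    rw [List.length_map, arity_map, hz]

omit [DecidableEq I] in
theorem card_piAntidiag_univ [DecidableEq I] :
    (Finset.piAntidiag (Finset.univ : Finset I) (Fintype.card I - 1)).card =
      (2 * Fintype.card I - 2).choose (Fintype.card I - 1) := by
  have h1 : (Finset.piAntidiag (Finset.univ : Finset I) (Fintype.card I - 1)).card =
      (Finset.finsuppAntidiag (Finset.univ : Finset I) (Fintype.card I - 1)).card := by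
    rw [Finset.finsuppAntidiag, Finset.card_map, Finset.card_attach]
  rw [h1, Finset.card_finsuppAntidiag_nat_eq_choose, Finset.card_univ]
  congr 1
  omega

theorem exists_finset_span (h : IsNovikov mul) (v : I → A) :
    ∃ s : Finset A, s.card ≤
        (2 * Fintype.card I - 2).choose (Fintype.card I - 1) ∧
      ∀ t : MultilinearWord I, evalWord mul v t.1 ∈ Submodule.span K (s : Set A) := by
  classical
  refine ⟨(Finset.piAntidiag Finset.univ (Fintype.card I - 1)).image (exponentMonomial mul v),
    Finset.card_image_le.trans ?_, fun t => ?_⟩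
  · rw [card_piAntidiag_univ]
  · have h1 := evalWord_mem_monomialSpan h v t.1
    suffices H : monomialSpan mul v t.1.letters ≤ (Submodule.span K
      (((Finset.piAntidiag Finset.univ (Fintype.card I - 1)).image
        (exponentMonomial mul v) : Finset A) : Set A)).toAddSubgroup from H h1
    refine (AddSubgroup.closure_le _).2 ?_
    rintro _ ⟨zs, ys, h2, h3, rfl⟩
    obtain ⟨a, ha, ha'⟩ := exists_exponentMonomial_eq h v h2 (h3.nodup_iff.2 t.2.1)
      fun i => h3.mem_iff.2 (t.2.2 i)
    rw [← ha']
    exact Submodule.subset_span (Finset.mem_coe.2 (Finset.mem_image_of_mem _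
      (Finset.mem_piAntidiag.2 ⟨ha, fun _ _ => Finset.mem_univ _⟩)))

/-! ### The defining identities evaluated in algebras, and the dimension bound for `Nov`. -/

section operad

open SymmOperad Mag

universe w

/-- The defining identities of Novikov algebras. -/
noncomputable def relations (K : Type w) [Field K] : Set ((Mag K).carrier (Fin 3)) :=
  {(leftMonomial K 1 - rightMonomial K 1) -
      (leftMonomial K (Equiv.swap 0 1) - rightMonomial K (Equiv.swap 0 1)),
    leftMonomial K 1 - leftMonomial K (Equiv.swap 1 2)}

end operad

end Novikov

namespace Mag

open FreeMagma

variable {K : Type u} [Field K] {A : Type*} [AddCommGroup A] [Module K A]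
  (mul : A →ₗ[K] A →ₗ[K] A)

theorem eval_leftMonomial (v : Fin 3 → A) (p : Equiv.Perm (Fin 3)) :
    eval mul v (leftMonomial K p) = mul (mul (v (p 0)) (v (p 1))) (v (p 2)) :=
  eval_word mul v _

theorem eval_rightMonomial (v : Fin 3 → A) (p : Equiv.Perm (Fin 3)) :
    eval mul v (rightMonomial K p) = mul (v (p 0)) (mul (v (p 1)) (v (p 2))) :=
  eval_word mul v _

end Mag

namespace Novikov

open SymmOperad Mag

variable {K : Type u} [Field K] {A : Type*} [AddCommGroup A] [Module K A]
  {mul : A →ₗ[K] A →ₗ[K] A}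

theorem isNovikov_iff :
    IsNovikov mul ↔ ∀ r ∈ relations K, ∀ v, eval mul v r = 0 := by
  have e2 : Equiv.swap (0 : Fin 3) 1 2 = 2 := by decide
  have e0 : Equiv.swap (1 : Fin 3) 2 0 = 0 := by decide
  simp only [relations, Set.mem_insert_iff, Set.mem_singleton_iff, forall_eq_or_imp, forall_eq,
    map_sub, eval_leftMonomial, eval_rightMonomial, Equiv.Perm.one_apply, Equiv.swap_apply_left,
    Equiv.swap_apply_right, e2, e0, sub_eq_zero]
  exact ⟨fun h => ⟨fun v => h.left_symm _ _ _, fun v => h.right_comm _ _ _⟩,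
    fun h => ⟨fun a b c => h.1 ![a, b, c], fun a b c => h.2 ![a, b, c]⟩⟩

theorem span_relations_le (h : IsNovikov mul) (I : Type) [Finite I] :
    (OperadIdeal.span (Mag K) (relations K)).carrier I ≤ (identities mul).carrier I :=
  span_le_identities mul (isNovikov_iff.1 h)

theorem finrank_le (K : Type u) [Field K] (I : Type) [Fintype I] :
    Module.Finite K ((Nov K).carrier I) ∧ Module.finrank K ((Nov K).carrier I) ≤
      (2 * Fintype.card I - 2).choose (Fintype.card I - 1) := by
  classical
  refine finrank_quotient_le (OperadIdeal.span (Mag K) (relations K)) ?_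
  intro A _ _ mul v hN
  refine exists_finset_span (isNovikov_iff.2 fun r hr v => ?_) v
  exact (mem_identities mul).1 (hN (Fin 3) (OperadIdeal.subset_span _ hr)) v

end Novikov

/-! ### Bicommutative algebras -/

/-- The identities of bicommutative algebras. -/
structure IsBicommutative {K A : Type*} [Field K] [AddCommGroup A] [Module K A]
    (mul : A →ₗ[K] A →ₗ[K] A) : Prop where
  left_comm : ∀ a b c, mul a (mul b c) = mul b (mul a c)
  right_comm : ∀ a b c, mul (mul a b) c = mul (mul a c) b

namespace FreeMagma

/-- The letters of a word that are left children (`c = true`) or right children (`c = false`),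
where `b` says which kind of child the word itself is. -/
def sideLetters {I : Type} (c : Bool) : Bool → FreeMagma I → List I
  | b, FreeMagma.of i => if b = c then [i] else []
  | _, FreeMagma.mul s t => sideLetters c true s ++ sideLetters c false t

theorem sideLetters_mul {I : Type} (c b : Bool) (s t : FreeMagma I) :
    sideLetters c b (s * t) = sideLetters c true s ++ sideLetters c false t := rfl

theorem sideLetters_perm {I : Type} (b : Bool) (t : FreeMagma I) :
    (sideLetters true b t ++ sideLetters false b t).Perm t.letters := by
  induction t using FreeMagma.recOnMul generalizing b with
  | ih1 i => cases b <;> simp [sideLetters, letters]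
  | ih2 s t hs ht =>
    rw [sideLetters_mul, sideLetters_mul, MultilinearWord.letters_mul, ← Multiset.coe_eq_coe]
    have hs := Multiset.coe_eq_coe.2 (hs true)
    have ht := Multiset.coe_eq_coe.2 (ht false)
    simp only [← Multiset.coe_add] at hs ht ⊢
    rw [← hs, ← ht]
    abel

/-- Descending always to the child of kind `b` ends at a letter of kind `b`; for a single letter
this is the kind assigned to the root. -/
theorem sideLetters_self_ne_nil {I : Type} (b : Bool) (t : FreeMagma I) :
    sideLetters b b t ≠ [] := by
  induction t using FreeMagma.recOnMul generalizing b with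
  | ih1 i => simp [sideLetters]
  | ih2 s t hs ht =>
    rw [sideLetters_mul]
    cases b
    · exact List.append_ne_nil_of_right_ne_nil _ (ht false)
    · exact List.append_ne_nil_of_left_ne_nil (hs true) _

theorem sideLetters_mul_ne_nil {I : Type} (c b : Bool) (s t : FreeMagma I) :
    sideLetters c b (s * t) ≠ [] := by
  rw [sideLetters_mul]
  cases c
  · exact List.append_ne_nil_of_right_ne_nil _ (sideLetters_self_ne_nil _ _)
  · exact List.append_ne_nil_of_left_ne_nil (sideLetters_self_ne_nil _ _) _

end FreeMagma

namespace Bicommutative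

open FreeMagma SymmOperad Mag

section algebra

variable {K A : Type*} [Field K] [AddCommGroup A] [Module K A] (mul : A →ₗ[K] A →ₗ[K] A)

/-- The normal form of a product with given left and right factors. -/
def monomial : List A → List A → A
  | p :: L, q :: R => L.foldr (fun a x => mul a x) (R.foldl (fun x b => mul x b) (mul p q))
  | _, _ => 0

variable {mul}

/-- Left and right multiplications commute on products. They need not commute on arbitrary elements,
hence the argument `mul u w`. -/
theorem mul_mul_comm (h : IsBicommutative mul) (a u w b : A) :
    mul (mul a (mul u w)) b = mul a (mul (mul u w) b) := by
  rw [h.right_comm u w b, h.left_comm a (mul u b) w, h.right_comm u b (mul a w),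
    h.left_comm a u w]

theorem exists_foldl_eq_mul (p q : A) (R : List A) :
    ∃ u w, R.foldl (fun x b => mul x b) (mul p q) = mul u w := by
  induction R generalizing p q with
  | nil => exact ⟨p, q, rfl⟩
  | cons b R ih => exact ih _ _

theorem mul_foldl (h : IsBicommutative mul) (a p q : A) (R : List A) :
    mul a (R.foldl (fun x b => mul x b) (mul p q)) =
      R.foldl (fun x b => mul x b) (mul a (mul p q)) := by
  induction R generalizing p q with
  | nil => rfl
  | cons b R ih => rw [List.foldl_cons, List.foldl_cons, ih, mul_mul_comm h]

theorem foldr_mul (h : IsBicommutative mul) (L : List A) (p q b : A) :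
    mul (L.foldr (fun a x => mul a x) (mul p q)) b =
      L.foldr (fun a x => mul a x) (mul (mul p q) b) := by
  induction L with
  | nil => rfl
  | cons a L ih =>
    rw [List.foldr_cons, List.foldr_cons, ← ih]
    obtain ⟨u, w, huw⟩ : ∃ u w, L.foldr (fun a x => mul a x) (mul p q) = mul u w := by
      cases L with
      | nil => exact ⟨p, q, rfl⟩
      | cons a' L => exact ⟨_, _, rfl⟩
    rw [huw, mul_mul_comm h]

theorem mul_foldr (h : IsBicommutative mul) (L : List A) (u x : A) :
    mul u (L.foldr (fun a x => mul a x) x) = L.foldr (fun a x => mul a x) (mul u x) := by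
  induction L with
  | nil => rfl
  | cons a L ih => rw [List.foldr_cons, List.foldr_cons, ← ih, h.left_comm]

theorem foldr_perm (h : IsBicommutative mul) {L L' : List A} (hL : L.Perm L') (x : A) :
    L.foldr (fun a x => mul a x) x = L'.foldr (fun a x => mul a x) x :=
  have : LeftCommutative fun (a x : A) => mul a x := ⟨fun a b c => h.left_comm a b c⟩
  hL.foldr_eq x

theorem foldl_perm (h : IsBicommutative mul) {L L' : List A} (hL : L.Perm L') (x : A) :
    L.foldl (fun x b => mul x b) x = L'.foldl (fun x b => mul x b) x :=
  have : RightCommutative fun (x b : A) => mul x b := ⟨fun a b c => h.right_comm a b c⟩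
  hL.foldl_eq x

/-- Only the head of `L` is special, since it stands innermost. To exchange it with `a`, the
multiplication by `a` is pushed through all the others down to the innermost product, where left
commutativity applies. -/
theorem monomial_perm_left (h : IsBicommutative mul) {L L' : List A} (hL : L.Perm L')
    (R : List A) : monomial mul L R = monomial mul L' R := by
  cases R with
  | nil => cases L <;> cases L' <;> rfl
  | cons q R =>
    induction hL with
    | nil => rfl
    | cons p hL _ => exact foldr_perm h hL _
    | swap a p L =>
      simp only [monomial, List.foldr_cons]
      rw [mul_foldr h, mul_foldl h, mul_foldr h, mul_foldl h, h.left_comm]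
    | trans _ _ ih1 ih2 => exact ih1.trans ih2

theorem monomial_perm_right (h : IsBicommutative mul) (L : List A) {R R' : List A}
    (hR : R.Perm R') : monomial mul L R = monomial mul L R' := by
  cases L with
  | nil => rfl
  | cons p L =>
    induction hR with
    | nil => rfl
    | cons q hR _ => simp only [monomial]; rw [foldl_perm h hR]
    | swap a q R =>
      simp only [monomial, List.foldl_cons]
      rw [h.right_comm]
    | trans _ _ ih1 ih2 => exact ih1.trans ih2

theorem monomial_cons_left (a : A) {L R : List A} (hL : L ≠ []) (hR : R ≠ [])
    (h : IsBicommutative mul) : monomial mul (a :: L) R = mul a (monomial mul L R) := by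
  obtain ⟨p, L, rfl⟩ := List.exists_cons_of_ne_nil hL
  obtain ⟨q, R, rfl⟩ := List.exists_cons_of_ne_nil hR
  rw [monomial_perm_left h (List.Perm.swap p a L)]
  rfl

theorem monomial_cons_right (b : A) {L R : List A} (hL : L ≠ []) (hR : R ≠ [])
    (h : IsBicommutative mul) : monomial mul L (b :: R) = mul (monomial mul L R) b := by
  obtain ⟨p, L, rfl⟩ := List.exists_cons_of_ne_nil hL
  obtain ⟨q, R, rfl⟩ := List.exists_cons_of_ne_nil hR
  have h1 : (b :: q :: R).Perm (q :: (R ++ [b])) :=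
    (List.Perm.swap q b R).trans ((List.perm_append_singleton b R).symm.cons q)
  rw [monomial_perm_right h _ h1]
  simp only [monomial, List.foldl_append, List.foldl_cons, List.foldl_nil]
  obtain ⟨u, w, huw⟩ := exists_foldl_eq_mul (mul := mul) p q R
  rw [huw, foldr_mul h]

theorem foldr_monomial (h : IsBicommutative mul) (M : List A) {L R : List A} (hL : L ≠ [])
    (hR : R ≠ []) : M.foldr (fun a x => mul a x) (monomial mul L R) =
      monomial mul (M ++ L) R := by
  induction M with
  | nil => rfl
  | cons a M ih =>
    rw [List.foldr_cons, ih, List.cons_append,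
      monomial_cons_left a (List.append_ne_nil_of_right_ne_nil M hL) hR h]

theorem foldl_monomial (h : IsBicommutative mul) (M : List A) {L R : List A} (hL : L ≠ [])
    (hR : R ≠ []) : M.foldl (fun x b => mul x b) (monomial mul L R) =
      monomial mul L (R ++ M) := by
  induction M generalizing R with
  | nil => rw [List.append_nil]; rfl
  | cons b M ih =>
    rw [List.foldl_cons, ← monomial_cons_right b hL hR h, ih (List.cons_ne_nil _ _)]
    exact monomial_perm_right h _ List.perm_middle.symm

/-- Let m be the first factor. Left multiplication by m passes through the multiplications of the
second factor to its innermost product p q, and m (p q) = p (m q) attaches p and q to m. The other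
multiplications then extend the two lists. -/
theorem monomial_mul_monomial (h : IsBicommutative mul) {L R L' R' : List A} (hL : L ≠ [])
    (hR : R ≠ []) (hL' : L' ≠ []) (hR' : R' ≠ []) :
    mul (monomial mul L R) (monomial mul L' R') = monomial mul (L ++ L') (R ++ R') := by
  obtain ⟨p, L', rfl⟩ := List.exists_cons_of_ne_nil hL'
  obtain ⟨q, R', rfl⟩ := List.exists_cons_of_ne_nil hR'
  conv_lhs => rw [monomial.eq_def mul (p :: L')]
  simp only
  rw [mul_foldr h, mul_foldl h, h.left_comm, ← monomial_cons_right q hL hR h,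
    ← monomial_cons_left p hL (List.cons_ne_nil _ _) h,
    foldl_monomial h _ (List.cons_ne_nil _ _) (List.cons_ne_nil _ _),
    foldr_monomial h _ (List.cons_ne_nil _ _) (by simp),
    monomial_perm_left h (L' := L ++ p :: L'), monomial_perm_right h]
  · exact List.perm_middle.symm
  · exact (List.perm_middle.trans ((List.perm_append_comm).cons p)).trans List.perm_middle.symm

/-- A single letter is not a `monomial`, because one of its lists would be empty; hence the separate
cases for factors that are letters. The kind `b` of the root is irrelevant for a product. -/
theorem evalWord_mul_eq (h : IsBicommutative mul) {I : Type} (v : I → A) (s t : FreeMagma I)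
    (b : Bool) :
    evalWord mul v (s * t) = monomial mul ((sideLetters true b (s * t)).map v)
      ((sideLetters false b (s * t)).map v) := by
  have key : ∀ (r : FreeMagma I), (∃ i, r = FreeMagma.of i) ∨ ∃ r₁ r₂, r = r₁ * r₂ := by
    rintro (i | ⟨r₁, r₂⟩)
    · exact Or.inl ⟨i, rfl⟩
    · exact Or.inr ⟨r₁, r₂, rfl⟩
  have hne : ∀ (c b : Bool) (s t : FreeMagma I), (sideLetters c b (s * t)).map v ≠ [] :=
    fun c b s t => by simpa using sideLetters_mul_ne_nil c b s t
  have H : ∀ (n : ℕ) (s t : FreeMagma I), s.length + t.length ≤ n → ∀ b : Bool,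
      evalWord mul v (s * t) = monomial mul ((sideLetters true b (s * t)).map v)
        ((sideLetters false b (s * t)).map v) := by
    intro n
    induction n with
    | zero =>
      intro s t hst
      have := s.length_pos
      omega
    | succ n ih =>
      intro s t hst b
      have hlen : ∀ a b : FreeMagma I, (a * b).length = a.length + b.length := fun _ _ => rfl
      rw [sideLetters_mul, sideLetters_mul, evalWord_mul, List.map_append, List.map_append]
      have hs0 := s.length_pos
      have ht0 := t.length_pos
      rcases key s with ⟨i, rfl⟩ | ⟨s₁, s₂, rfl⟩
      · rcases key t with ⟨j, rfl⟩ | ⟨t₁, t₂, rfl⟩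
        · rfl
        · rw [hlen] at hst
          rw [ih t₁ t₂ (by omega) false]
          exact (monomial_cons_left (v i) (hne _ _ _ _) (hne _ _ _ _) h).symm
      · rw [hlen] at hst
        rcases key t with ⟨j, rfl⟩ | ⟨t₁, t₂, rfl⟩
        · rw [ih s₁ s₂ (by omega) true]
          refine (monomial_cons_right (v j) (hne _ _ _ _) (hne _ _ _ _) h).symm.trans ?_
          refine (monomial_perm_right h _ (List.perm_append_singleton _ _).symm).trans ?_
          refine monomial_perm_left h ?_ _
          simp [sideLetters]
        · rw [hlen] at hst
          have hs1 := s₁.length_pos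
          have ht1 := t₁.length_pos
          rw [ih s₁ s₂ (by omega) true, ih t₁ t₂ (by omega) false,
            monomial_mul_monomial h (hne _ _ _ _) (hne _ _ _ _) (hne _ _ _ _) (hne _ _ _ _)]
  exact H _ s t le_rfl b

variable {I : Type} [Fintype I] [DecidableEq I]

theorem exists_finset_span (h : IsBicommutative mul) (hI : 2 ≤ Fintype.card I) (v : I → A) :
    ∃ s : Finset A, s.card ≤ 2 ^ Fintype.card I - 2 ∧
      ∀ t : MultilinearWord I, evalWord mul v t.1 ∈ Submodule.span K (s : Set A) := by
  classical
  have : Nonempty I := Fintype.card_pos_iff.1 (by omega)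
  -- The left letters of a product form a nonempty proper subset, which leaves 2^n - 2
  -- possibilities.
  refine ⟨((Finset.univ : Finset (Finset I)) \ {∅, Finset.univ}).image fun s =>
    monomial mul (s.toList.map v) (sᶜ.toList.map v), Finset.card_image_le.trans ?_, ?_⟩
  · rw [Finset.card_sdiff_of_subset (Finset.subset_univ _), Finset.card_univ, Fintype.card_finset,
      Finset.card_pair Finset.univ_nonempty.ne_empty.symm]
  · rintro ⟨t, ht, hu⟩
    refine Submodule.subset_span ?_
    rcases t with i | ⟨s, t⟩
    · exfalso
      have h1 : ∀ j : I, j = i := fun j => by simpa [letters] using hu j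
      have := Fintype.card_le_one_iff_subsingleton.2 ⟨fun a b => (h1 a).trans (h1 b).symm⟩
      omega
    · have hp := sideLetters_perm true (s * t)
      have hn := hp.nodup_iff.2 ht
      have hu' := fun i => hp.mem_iff.2 (hu i)
      have hL := sideLetters_mul_ne_nil true true s t
      have hR := sideLetters_mul_ne_nil false true s t
      have hev := evalWord_mul_eq h v s t true
      generalize sideLetters true true (s * t) = L at *
      generalize sideLetters false true (s * t) = R at *
      rw [List.nodup_append] at hn
      refine Finset.mem_coe.2 (Finset.mem_image.2 ⟨L.toFinset, ?_, ?_⟩)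
      · simp only [Finset.mem_sdiff, Finset.mem_univ, Finset.mem_insert, Finset.mem_singleton,
          true_and, not_or]
        refine ⟨by simpa using hL, fun hL' => ?_⟩
        obtain ⟨r, R, rfl⟩ := List.exists_cons_of_ne_nil hR
        have hr : r ∈ L := List.mem_toFinset.1 (hL' ▸ Finset.mem_univ r)
        exact hn.2.2 r hr r (by simp) rfl
      · refine Eq.trans ?_ hev.symm
        have h1 : L.toFinset.toList.Perm L := List.toFinset_toList hn.1
        have h2 : L.toFinsetᶜ.toList.Perm R := by
          rw [List.perm_ext_iff_of_nodup (Finset.nodup_toList _) hn.2.1]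
          intro i
          simp only [Finset.mem_toList, Finset.mem_compl, List.mem_toFinset]
          exact ⟨fun hi => (List.mem_append.1 (hu' i)).resolve_left hi,
            fun hi hi' => hn.2.2 i hi' i hi rfl⟩
        rw [monomial_perm_left h (h1.map v), monomial_perm_right h _ (h2.map v)]

end algebra

/-! ### The dimension bound for `BiCom`. -/

section operad

variable {K : Type u} [Field K]

/-- The defining identities of bicommutative algebras. -/
noncomputable def relations (K : Type u) [Field K] : Set ((Mag K).carrier (Fin 3)) :=
  {rightMonomial K 1 - rightMonomial K (Equiv.swap 0 1),
    leftMonomial K 1 - leftMonomial K (Equiv.swap 1 2)}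

variable {A : Type*} [AddCommGroup A] [Module K A] {mul : A →ₗ[K] A →ₗ[K] A}

theorem isBicommutative_iff :
    IsBicommutative mul ↔ ∀ r ∈ relations K, ∀ v, eval mul v r = 0 := by
  have e2 : Equiv.swap (0 : Fin 3) 1 2 = 2 := by decide
  have e0 : Equiv.swap (1 : Fin 3) 2 0 = 0 := by decide
  simp only [relations, Set.mem_insert_iff, Set.mem_singleton_iff, forall_eq_or_imp, forall_eq,
    map_sub, eval_leftMonomial, eval_rightMonomial, Equiv.Perm.one_apply, Equiv.swap_apply_left,
    Equiv.swap_apply_right, e2, e0, sub_eq_zero]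
  exact ⟨fun h => ⟨fun v => h.left_comm _ _ _, fun v => h.right_comm _ _ _⟩,
    fun h => ⟨fun a b c => h.1 ![a, b, c], fun a b c => h.2 ![a, b, c]⟩⟩

theorem span_relations_le (h : IsBicommutative mul) (I : Type) [Finite I] :
    (OperadIdeal.span (Mag K) (relations K)).carrier I ≤ (identities mul).carrier I :=
  span_le_identities mul (isBicommutative_iff.1 h)

theorem finrank_le (K : Type u) [Field K] (I : Type) [Fintype I] (hI : 2 ≤ Fintype.card I) :
    Module.Finite K ((BiCom K).carrier I) ∧ Module.finrank K ((BiCom K).carrier I) ≤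
      2 ^ Fintype.card I - 2 := by
  classical
  refine finrank_quotient_le (OperadIdeal.span (Mag K) (relations K)) ?_
  intro A _ _ mul v hN
  refine exists_finset_span (isBicommutative_iff.2 fun r hr v => ?_) hI v
  exact (mem_identities mul).1 (hN (Fin 3) (OperadIdeal.subset_span _ hr)) v

end operad

end Bicommutative

/-! ### Generation of the monomials of weight `-1` with two sides -/

namespace SidedMonomial

variable {K D I : Type*} [Field K] [CommRing D] [Algebra K D]

/-- The product of the elements `y i s k`, where `s` is the side of the letter `i` and `k` the order
of its derivative. -/
def value (y : I × Bool × ℕ → D) (m : Multiset (I × Bool × ℕ)) : D := (m.map y).prod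

/-- The letters of a sided monomial. -/
def content (m : Multiset (I × Bool × ℕ)) : Multiset I := m.map Prod.fst

/-- The total order of the derivatives. -/
def order (m : Multiset (I × Bool × ℕ)) : ℕ := (m.map fun q => q.2.2).sum

variable (d : Derivation K D D) (y : I × Bool × ℕ → D)

@[simp] theorem value_cons (q : I × Bool × ℕ) (m : Multiset (I × Bool × ℕ)) :
    value y (q ::ₘ m) = y q * value y m := by simp [value]

@[simp] theorem value_add (m m' : Multiset (I × Bool × ℕ)) :
    value y (m + m') = value y m * value y m' := by simp [value]

@[simp] theorem content_cons (q : I × Bool × ℕ) (m : Multiset (I × Bool × ℕ)) :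
    content (q ::ₘ m) = q.1 ::ₘ content m := by simp [content]

@[simp] theorem content_add (m m' : Multiset (I × Bool × ℕ)) :
    content (m + m') = content m + content m' := by simp [content]

@[simp] theorem order_cons (q : I × Bool × ℕ) (m : Multiset (I × Bool × ℕ)) :
    order (q ::ₘ m) = q.2.2 + order m := by simp [order]

@[simp] theorem order_add (m m' : Multiset (I × Bool × ℕ)) :
    order (m + m') = order m + order m' := by simp [order]

/-- The class of families of subspaces closed under the operations `x d(p)` and `d(x) p`, for
letters `x` on either side, and containing these products for two letters. -/
structure Closed (T : Multiset I → Submodule K D) : Prop where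
  base : ∀ i j s s', s ≠ s' → y (i, s, 0) * y (j, s', 1) ∈ T (i ::ₘ {j})
  mul_deriv : ∀ i s t p, p ∈ T t → y (i, s, 0) * d p ∈ T (i ::ₘ t)
  deriv_mul : ∀ i s t p, p ∈ T t → y (i, s, 1) * p ∈ T (i ::ₘ t)

variable {d y}

/-- The Leibniz rule: `c * d (value y m)` is a sum of terms in which one order is raised by one. -/
theorem mul_deriv_value_mem (hy : ∀ i s k, d (y (i, s, k)) = y (i, s, k + 1))
    (E : Submodule K D) (c : D) (m : Multiset (I × Bool × ℕ))
    (h : ∀ i s k m', m = (i, s, k) ::ₘ m' → c * (y (i, s, k + 1) * value y m') ∈ E) :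
    c * d (value y m) ∈ E := by
  induction m using Multiset.induction_on generalizing c with
  | empty => simp [value]
  | cons q m ih =>
    obtain ⟨i, s, k⟩ := q
    rw [value_cons, Derivation.leibniz, smul_eq_mul, smul_eq_mul, hy, mul_add, ← mul_assoc]
    refine add_mem (ih _ fun i' s' k' m' hm => ?_) ?_
    · have := h i' s' k' ((i, s, k) ::ₘ m') (by rw [hm, Multiset.cons_swap])
      rw [value_cons] at this
      convert this using 1
      ring
    · rw [mul_comm (value y m)]
      exact h i s k m rfl

/-- Let X be the letter `i` with order n + 1. For a further letter x of order 0, x d(X Z p) is the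
wanted x d(X) Z p plus two kinds of terms. The term X Z (x d(p)) is the induction hypothesis for x
d(p). A term in which d falls on a letter z of `Z` is d(z) times an instance of the induction
hypothesis with x in the place of z. -/
theorem Closed.mul_zeros_mem {T : Multiset I → Submodule K D} (hT : Closed d y T)
    (hy : ∀ i s k, d (y (i, s, k)) = y (i, s, k + 1)) (i : I) (s : Bool) (n : ℕ)
    {Z : Multiset (I × Bool × ℕ)} (hZ : Z.card = n) (hZ0 : ∀ q ∈ Z, q.2.2 = 0)
    {t : Multiset I} {p : D} (hp : p ∈ T t) :
    y (i, s, n + 1) * (value y Z * p) ∈ T (i ::ₘ (content Z + t)) := by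
  induction n generalizing Z t p with
  | zero =>
    obtain rfl := Multiset.card_eq_zero.1 hZ
    simpa [value, content] using hT.deriv_mul i s t p hp
  | succ n ih =>
    obtain ⟨⟨x, b, k⟩, Z, rfl⟩ : ∃ x Z', Z = x ::ₘ Z' := by
      obtain ⟨x, hx⟩ := Multiset.card_pos_iff_exists_mem.1 (by rw [hZ]; exact n.succ_pos)
      exact ⟨x, _, (Multiset.exists_cons_of_mem hx).choose_spec⟩
    obtain rfl : k = 0 := hZ0 _ (Multiset.mem_cons_self _ _)
    rw [Multiset.card_cons, Nat.add_right_cancel_iff] at hZ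
    have hZ0' : ∀ q ∈ Z, q.2.2 = 0 := fun q hq => hZ0 q (Multiset.mem_cons_of_mem hq)
    rw [content_cons, value_cons]
    simp only
    have h0 := hT.mul_deriv x b _ _ (ih hZ hZ0' hp)
    have h1 := ih hZ hZ0' (hT.mul_deriv x b t p hp)
    have hset1 : i ::ₘ (content Z + x ::ₘ t) = i ::ₘ (x ::ₘ content Z + t) := by
      simp only [← Multiset.singleton_add]; abel
    have hset0 : x ::ₘ i ::ₘ (content Z + t) = i ::ₘ (x ::ₘ content Z + t) := by
      simp only [← Multiset.singleton_add]; abel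
    rw [hset1] at h1
    rw [hset0] at h0
    have h2 : y (x, b, 0) * y (i, s, n + 1) * p * d (value y Z) ∈
        T (i ::ₘ (x ::ₘ content Z + t)) := by
      refine mul_deriv_value_mem hy _ _ _ fun j s' k m' hm => ?_
      subst hm
      obtain rfl : k = 0 := hZ0' _ (Multiset.mem_cons_self _ _)
      have h3 := hT.deriv_mul j s' _ _ (ih (Z := (x, b, 0) ::ₘ m') (by simpa using hZ)
        (by
          intro q hq
          rcases Multiset.mem_cons.1 hq with rfl | hq
          · rfl
          · exact hZ0' q (Multiset.mem_cons_of_mem hq)) hp)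
      have hset : j ::ₘ i ::ₘ (content ((x, b, 0) ::ₘ m') + t) =
          i ::ₘ (x ::ₘ content ((j, s', 0) ::ₘ m') + t) := by
        simp only [content_cons]
        simp only [← Multiset.singleton_add]
        abel
      rw [hset] at h3
      convert h3 using 1
      rw [value_cons]
      ring
    convert sub_mem (sub_mem h0 h1) h2 using 1
    simp only [Derivation.leibniz, smul_eq_mul, hy]
    ring

theorem card_le_order {W : Multiset (I × Bool × ℕ)} (h : ∀ q ∈ W, q.2.2 ≠ 0) :
    W.card ≤ order W := by
  induction W using Multiset.induction_on with
  | empty => simp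
  | cons q W ih =>
    have h1 := h q (Multiset.mem_cons_self _ _)
    have h2 := ih fun r hr => h r (Multiset.mem_cons_of_mem hr)
    rw [Multiset.card_cons, order_cons]
    omega

theorem order_eq_zero {Z : Multiset (I × Bool × ℕ)} (h : ∀ q ∈ Z, q.2.2 = 0) :
    order Z = 0 := by
  refine Multiset.sum_eq_zero fun x hx => ?_
  obtain ⟨q, hq, rfl⟩ := Multiset.mem_map.1 hx
  exact h q hq

/-- A monomial with letters on both sides. -/
def TwoSided (m : Multiset (I × Bool × ℕ)) : Prop := ∃ q ∈ m, ∃ r ∈ m, q.2.1 ≠ r.2.1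

theorem TwoSided.exists_ne {m : Multiset (I × Bool × ℕ)} (h : TwoSided m) (s : Bool) :
    ∃ q ∈ m, q.2.1 ≠ s := by
  obtain ⟨q, hq, r, hr, hqr⟩ := h
  by_cases hs : q.2.1 = s
  · exact ⟨r, hr, fun e => hqr (hs.trans e.symm)⟩
  · exact ⟨q, hq, hs⟩

/-- Keep back `z` in `W` and `x` in `Z` on opposite sides, and split off another letter of `W`, of
order k + 1, together with k letters of order 0. The rest is shorter, still two-sided, and its order
is still its size minus one; `mul_zeros_mem` puts the removed letters back. -/
theorem Closed.value_mem_of_two_le {T : Multiset I → Submodule K D} (hT : Closed d y T)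
    (hy : ∀ i s k, d (y (i, s, k)) = y (i, s, k + 1)) {Z W : Multiset (I × Bool × ℕ)}
    (ih : ∀ m : Multiset (I × Bool × ℕ), m.card < (Z + W).card → order m + 1 = m.card →
      TwoSided m → value y m ∈ T (content m))
    (hZ : ∀ q ∈ Z, q.2.2 = 0) (hW : ∀ q ∈ W, q.2.2 ≠ 0) (hm : order (Z + W) + 1 = (Z + W).card)
    (h2 : TwoSided (Z + W)) (hW2 : 2 ≤ W.card) : value y (Z + W) ∈ T (content (Z + W)) := by
  have hoZ := order_eq_zero hZ
  -- If the first choices of `z` and `x` share a side, a letter on the other side replaces `x` or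
  -- `z`, according to whether it lies in `Z` or in `W`.
  obtain ⟨z, hz, x, hx, hzx⟩ : ∃ z ∈ W, ∃ x ∈ Z, z.2.1 ≠ x.2.1 := by
    obtain ⟨z, hz⟩ := Multiset.card_pos_iff_exists_mem.1 (show 0 < W.card by omega)
    have hoW := card_le_order hW
    obtain ⟨x, hx⟩ := Multiset.card_pos_iff_exists_mem.1 (show 0 < Z.card by
      rw [order_add, Multiset.card_add] at hm; omega)
    by_cases hzx : z.2.1 = x.2.1
    · obtain ⟨q, hq, hqs⟩ := h2.exists_ne z.2.1
      rcases Multiset.mem_add.1 hq with hq | hq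
      · exact ⟨z, hz, q, hq, hqs.symm⟩
      · exact ⟨q, hq, x, hx, hzx ▸ hqs⟩
    · exact ⟨z, hz, x, hx, hzx⟩
  obtain ⟨W, rfl⟩ := Multiset.exists_cons_of_mem hz
  obtain ⟨Z, rfl⟩ := Multiset.exists_cons_of_mem hx
  rw [Multiset.card_cons] at hW2
  obtain ⟨⟨i, s, k⟩, hi⟩ := Multiset.card_pos_iff_exists_mem.1 (show 0 < W.card by omega)
  obtain ⟨W, rfl⟩ := Multiset.exists_cons_of_mem hi
  have hk : k ≠ 0 := hW (i, s, k) (by simp)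
  have hz0 : z.2.2 ≠ 0 := hW z (by simp)
  have hx0 : x.2.2 = 0 := hZ x (by simp)
  have hoW := card_le_order (W := W) fun q hq => hW q (by simp [hq])
  obtain ⟨k, rfl⟩ := Nat.exists_eq_succ_of_ne_zero hk
  simp only [order_add, order_cons, Multiset.card_add, Multiset.card_cons] at hm hoZ ih
  -- There are k such letters besides `x`: all orders in `W` are positive, and the total order is
  -- the number of letters minus one.
  obtain ⟨Z₁, hZ₁⟩ := Multiset.card_pos_iff_exists_mem.1
    (show 0 < (Multiset.powersetCard k Z).card by
      rw [Multiset.card_powersetCard]; exact Nat.choose_pos (by omega))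
  obtain ⟨hZ₁, hZ₁'⟩ := Multiset.mem_powersetCard.1 hZ₁
  obtain ⟨Z₂, rfl⟩ := Multiset.le_iff_exists_add.1 hZ₁
  simp only [order_add, Multiset.card_add] at hm hoZ ih
  have h3 := ih (z ::ₘ x ::ₘ (Z₂ + W))
    (by simp only [Multiset.card_add, Multiset.card_cons]; omega)
    (by simp only [order_add, order_cons, Multiset.card_add, Multiset.card_cons]; omega)
    ⟨z, by simp, x, by simp, hzx⟩
  have h4 := hT.mul_zeros_mem hy i s k hZ₁' (fun q hq => hZ q (by simp [hq])) h3
  have hset : i ::ₘ (content Z₁ + content (z ::ₘ x ::ₘ (Z₂ + W))) =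
      content (x ::ₘ (Z₁ + Z₂) + z ::ₘ (i, s, k + 1) ::ₘ W) := by
    simp only [content_cons, content_add]
    simp only [← Multiset.singleton_add]
    abel
  rw [hset] at h4
  convert h4 using 1
  simp only [value_cons, value_add]
  ring

/-- If only one letter is differentiated, with order k + 1 ≥ 2, apply x₂ d(·) to the shorter
monomial with order k, keeping a letter on the opposite side. Every unwanted term has two
differentiated letters and is covered by the preceding lemma. Two letters are the base case. -/
theorem Closed.value_mem {T : Multiset I → Submodule K D} (hT : Closed d y T)
    (hy : ∀ i s k, d (y (i, s, k)) = y (i, s, k + 1)) {m : Multiset (I × Bool × ℕ)}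
    (hm : order m + 1 = m.card) (h2 : TwoSided m) : value y m ∈ T (content m) := by
  induction hn : m.card using Nat.strong_induction_on generalizing m with
  | _ n ih =>
  subst hn
  have ih' : ∀ m' : Multiset (I × Bool × ℕ), m'.card < m.card → order m' + 1 = m'.card →
      TwoSided m' → value y m' ∈ T (content m') := fun m' h1 h2 h3 => ih _ h1 h2 h3 rfl
  clear ih
  have hsplit : ∃ Z W, m = Z + W ∧ (∀ q ∈ Z, q.2.2 = 0) ∧ ∀ q ∈ W, q.2.2 ≠ 0 :=
    ⟨m.filter fun q => q.2.2 = 0, m.filter fun q => ¬ q.2.2 = 0,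
      (Multiset.filter_add_not _ m).symm, fun q hq => (Multiset.mem_filter.1 hq).2,
      fun q hq => (Multiset.mem_filter.1 hq).2⟩
  obtain ⟨Z, W, rfl, hZ, hW⟩ := hsplit
  by_cases hW2 : 2 ≤ W.card
  · exact hT.value_mem_of_two_le hy ih' hZ hW hm h2 hW2
  have hoZ := order_eq_zero hZ
  have hcard : 2 ≤ (Z + W).card := by
    obtain ⟨q, hq, r, hr, hqr⟩ := h2
    obtain ⟨m', hm'⟩ := Multiset.exists_cons_of_mem hq
    rw [hm', Multiset.mem_cons] at hr
    rcases hr with rfl | hr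
    · exact absurd rfl hqr
    · have := Multiset.card_pos_iff_exists_mem.2 ⟨r, hr⟩
      rw [hm', Multiset.card_cons]
      omega
  obtain ⟨⟨i, s, k⟩, rfl⟩ : ∃ q, W = {q} := by
    rw [← Multiset.card_eq_one]
    have : W.card ≠ 0 := by
      intro h0
      obtain rfl := Multiset.card_eq_zero.1 h0
      simp only [add_zero] at hm hcard
      omega
    omega
  obtain ⟨⟨x, b, l⟩, hx, hxs⟩ := h2.exists_ne s
  have hxZ : (x, b, l) ∈ Z := by
    rcases Multiset.mem_add.1 hx with hx | hx
    · exact hx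
    · rw [Multiset.mem_singleton] at hx
      exact absurd (congrArg (fun q => q.2.1) hx) hxs
  obtain rfl : l = 0 := hZ _ hxZ
  obtain ⟨Z, rfl⟩ := Multiset.exists_cons_of_mem hxZ
  simp only at hxs
  have hk : order ({(i, s, k)} : Multiset (I × Bool × ℕ)) = k := by simp [order]
  rw [order_add, hoZ, hk, Multiset.card_add, Multiset.card_cons, Multiset.card_singleton] at hm
  rcases Multiset.empty_or_exists_mem Z with rfl | ⟨⟨x₂, b₂, l⟩, hx₂⟩
  · obtain rfl : k = 1 := by simpa using hm
    have := hT.base x i b s hxs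
    simpa [value, content] using this
  · obtain rfl : l = 0 := hZ (x₂, b₂, l) (by simp [hx₂])
    obtain ⟨Z, rfl⟩ := Multiset.exists_cons_of_mem hx₂
    rw [Multiset.card_cons] at hm
    obtain ⟨k, rfl⟩ : ∃ k', k = k' + 1 := ⟨k - 1, by omega⟩
    have hZ0 : order ((x, b, 0) ::ₘ Z) = 0 :=
      order_eq_zero fun q hq => hZ q (by
        rcases Multiset.mem_cons.1 hq with rfl | hq
        · simp
        · simp [hq])
    have h1 := ih' ((i, s, k) ::ₘ (x, b, 0) ::ₘ Z) (by simp)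
      (by rw [order_cons, hZ0, Multiset.card_cons, Multiset.card_cons]; simp only; omega)
      ⟨(i, s, k), by simp, (x, b, 0), by simp, hxs.symm⟩
    have h3 := hT.mul_deriv x₂ b₂ _ _ h1
    have hset : x₂ ::ₘ content ((i, s, k) ::ₘ (x, b, 0) ::ₘ Z) =
        content ((x, b, 0) ::ₘ (x₂, b₂, 0) ::ₘ Z + {(i, s, k + 1)}) := by
      rw [← Multiset.cons_zero (i, s, k + 1)]
      simp only [content_cons, content_add]
      simp only [← Multiset.singleton_add]
      abel
    rw [hset] at h3
    have h4 : y (x₂, b₂, 0) * y (i, s, k) * d (value y ((x, b, 0) ::ₘ Z)) ∈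
        T (content ((x, b, 0) ::ₘ (x₂, b₂, 0) ::ₘ Z + {(i, s, k + 1)})) := by
      refine mul_deriv_value_mem hy _ _ _ fun j s' l m' hm' => ?_
      have hm'0 : order ((j, s', l) ::ₘ m') = 0 := hm' ▸ hZ0
      have hm'c := congrArg Multiset.card hm'
      rw [order_cons, Nat.add_eq_zero_iff] at hm'0
      obtain ⟨hl, hm'0⟩ := hm'0
      simp only at hl
      subst hl
      have hkpos : k ≠ 0 := by omega
      have hset2 : content ((x, b, 0) ::ₘ (x₂, b₂, 0) ::ₘ Z + {(i, s, k + 1)}) =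
          content ((x₂, b₂, 0) ::ₘ m' + (i, s, k) ::ₘ (j, s', 1) ::ₘ 0) := by
        have := congrArg content hm'
        rw [← Multiset.cons_zero (i, s, k + 1), Multiset.cons_swap, Multiset.cons_add]
        simp only [content_cons, content_add] at this ⊢
        rw [this]
        simp only [← Multiset.singleton_add]
        abel
      have h5 := hT.value_mem_of_two_le hy (Z := (x₂, b₂, 0) ::ₘ m')
        (W := (i, s, k) ::ₘ (j, s', 1) ::ₘ 0) (fun m h => ih' m (h.trans_le ?_)) ?_ ?_ ?_ ?_ ?_
      · rw [hset2]
        convert h5 using 1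
        simp only [value_cons, value_add]
        simp [value]
        ring
      · simp only [Multiset.card_add, Multiset.card_cons, Multiset.card_zero,
          Multiset.card_singleton] at hm'c ⊢
        omega
      · intro q hq
        rcases Multiset.mem_cons.1 hq with rfl | hq
        · rfl
        · have : q ∈ (x, b, 0) ::ₘ Z := by rw [hm']; exact Multiset.mem_cons_of_mem hq
          refine hZ q ?_
          rcases Multiset.mem_cons.1 this with rfl | hq
          · simp
          · simp [hq]
      · intro q hq
        rcases Multiset.mem_cons.1 hq with rfl | hq
        · exact hkpos
        · rcases Multiset.mem_cons.1 hq with rfl | hq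
          · exact one_ne_zero
          · exact absurd hq (Multiset.notMem_zero q)
      · simp only [order_add, order_cons, hm'0, Multiset.card_add, Multiset.card_cons,
          Multiset.card_zero] at hm'c ⊢
        simp only [order, Multiset.map_zero, Multiset.sum_zero]
        omega
      -- If `x` is the letter just differentiated, it is now in `W`, but still on the side opposite
      -- to `i`.
      · have : (x, b, 0) ∈ (j, s', 0) ::ₘ m' := hm' ▸ Multiset.mem_cons_self _ _
        rcases Multiset.mem_cons.1 this with h6 | h6
        · refine ⟨(j, s', 1), by simp, (i, s, k), by simp, ?_⟩
          have : b = s' := congrArg (fun q => q.2.1) h6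
          exact this ▸ hxs
        · exact ⟨(x, b, 0), by simp [h6], (i, s, k), by simp, hxs⟩
      · simp
    convert sub_mem h3 h4 using 1
    rw [← Multiset.cons_zero (i, s, k + 1)]
    simp only [value_cons, value_add, Derivation.leibniz, smul_eq_mul, hy]
    simp [value]
    ring

end SidedMonomial

/-! ### The white Manin product of the bicommutative and the Novikov operad -/

namespace BiComNov

open SymmOperad Mag FreeMagma

variable {K : Type u} [Field K] {S D : Type*} [CommRing S] [Algebra K S] [CommRing D] [Algebra K D]

variable (K S) in
/-- The bicommutative multiplication `(a, b) (c, e) = (a e, a e)`. -/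
noncomputable def sideMul : (S × S) →ₗ[K] (S × S) →ₗ[K] (S × S) :=
  LinearMap.mk₂ K (fun x y => (x.1 * y.2, x.1 * y.2))
    (fun x x' y => by simp [add_mul]) (fun c x y => by simp)
    (fun x y y' => by simp [mul_add]) (fun c x y => by simp)

@[simp] theorem sideMul_apply (x y : S × S) : sideMul K S x y = (x.1 * y.2, x.1 * y.2) := rfl

theorem isBicommutative_sideMul : IsBicommutative (sideMul K S) where
  left_comm a b c := by simp; ring
  right_comm a b c := by simp; ring

/-- The Novikov multiplication `a d(b)`. -/
noncomputable def derMul (d : Derivation K D D) : D →ₗ[K] D →ₗ[K] D :=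
  LinearMap.mk₂ K (fun x y => x * d y)
    (fun x x' y => by simp [add_mul]) (fun c x y => by simp)
    (fun x y y' => by simp [mul_add]) (fun c x y => by simp)

@[simp] theorem derMul_apply (d : Derivation K D D) (x y : D) : derMul d x y = x * d y := rfl

theorem isNovikov_derMul (d : Derivation K D D) : IsNovikov (derMul d) where
  left_symm a b c := by simp; ring
  right_comm a b c := by simp; ring

/-- The action of `BiCom` on pairs. -/
noncomputable def evalBiCom {J : Type} [Finite J] (v : J → S × S) :
    (BiCom K).carrier J →ₗ[K] S × S :=
  evalQuotient (Bicommutative.span_relations_le isBicommutative_sideMul) v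

/-- The action of `Nov` on a differential algebra. -/
noncomputable def evalNov (d : Derivation K D D) {J : Type} [Finite J] (w : J → D) :
    (Nov K).carrier J →ₗ[K] D :=
  evalQuotient (Novikov.span_relations_le (isNovikov_derMul d)) w

/-- The product of two letters in either order. -/
def binaryWord (c : Bool) : MultilinearWord (Fin 2) :=
  ⟨if c then FreeMagma.of 0 * FreeMagma.of 1 else FreeMagma.of 1 * FreeMagma.of 0, by
    cases c
    · change [1, 0].Nodup ∧ ∀ i : Fin 2, i ∈ [1, 0]; decide
    · change [0, 1].Nodup ∧ ∀ i : Fin 2, i ∈ [0, 1]; decide⟩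

variable (K) in
/-- A monomial as an element of `BiCom`. -/
noncomputable def biComWord {J : Type} [Finite J] (t : MultilinearWord J) :
    (BiCom K).carrier J :=
  mk (OperadIdeal.span (Mag K) (Bicommutative.relations K)) J (word t)

variable (K) in
/-- A monomial as an element of `Nov`. -/
noncomputable def novWord {J : Type} [Finite J] (t : MultilinearWord J) :
    (Nov K).carrier J :=
  mk (OperadIdeal.span (Mag K) (Novikov.relations K)) J (word t)

theorem evalBiCom_word {J : Type} [Finite J] (v : J → S × S) (t : MultilinearWord J) :
    evalBiCom v (biComWord K t) = evalWord (sideMul K S) v t.1 :=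
  eval_word _ v t

theorem evalNov_word (d : Derivation K D D) {J : Type} [Finite J] (w : J → D)
    (t : MultilinearWord J) : evalNov d w (novWord K t) = evalWord (derMul d) w t.1 :=
  eval_word _ w t

theorem evalBiCom_comp {J : Type} [Finite J] (a : S × S) (v : J → S × S) (c : Bool)
    (b : (BiCom K).carrier J) :
    evalBiCom (Sum.elim (fun _ => a) v) ((BiCom K).comp (1 : Fin 2) (biComWord K (binaryWord c)) b) =
      if c then sideMul K S a (evalBiCom v b) else sideMul K S (evalBiCom v b) a := by
  refine (evalQuotient_comp _ _ _ _ _).trans ?_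
  refine (evalBiCom_word _ _).trans ?_
  cases c <;> simp [binaryWord, plug] <;> rfl

theorem evalNov_comp (d : Derivation K D D) {J : Type} [Finite J] (x : D) (w : J → D) (c : Bool)
    (b : (Nov K).carrier J) :
    evalNov d (Sum.elim (fun _ => x) w) ((Nov K).comp (1 : Fin 2) (novWord K (binaryWord c)) b) =
      if c then derMul d x (evalNov d w b) else derMul d (evalNov d w b) x := by
  refine (evalQuotient_comp _ _ _ _ _).trans ?_
  refine (evalNov_word _ _ _).trans ?_
  cases c <;> simp [binaryWord, plug] <;> rfl

/-- A pure tensor in the Hadamard product. -/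
def pureTensor {P Q : SymmOperad K} {J : Type} [Finite J] (b : P.carrier J) (n : Q.carrier J) :
    (hadamard P Q).carrier J := b ⊗ₜ[K] n

theorem hadamard_induction {P Q : SymmOperad K} {J : Type} [Finite J]
    {p : (hadamard P Q).carrier J → Prop} (zero : p 0)
    (tmul : ∀ b n, p (pureTensor b n)) (add : ∀ x y, p x → p y → p (x + y))
    (σ : (hadamard P Q).carrier J) : p σ :=
  TensorProduct.induction_on (motive := p) σ zero tmul add

variable (d : Derivation K D D) (ι : S →ₐ[K] D)

/-- The action of the Hadamard product, with one of the two coordinates of the values of the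
bicommutative factor. -/
noncomputable def evalTensor (π : S × S →ₗ[K] S) {J : Type} [Finite J] (v : J → S × S)
    (w : J → D) : (hadamard (BiCom K) (Nov K)).carrier J →ₗ[K] D :=
  LinearMap.mul' K D ∘ₗ TensorProduct.map (ι.toLinearMap ∘ₗ π ∘ₗ evalBiCom v) (evalNov d w)

theorem evalTensor_tmul (π : S × S →ₗ[K] S) {J : Type} [Finite J] (v : J → S × S)
    (w : J → D) (b : (BiCom K).carrier J) (n : (Nov K).carrier J) :
    evalTensor d ι π v w (pureTensor b n) = ι (π (evalBiCom v b)) * evalNov d w n := rfl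

theorem evalTensor_relabel (π : S × S →ₗ[K] S) {J L : Type} [Finite J] [Finite L]
    (e : J ≃ L) (v : L → S × S) (w : L → D) (σ : (hadamard (BiCom K) (Nov K)).carrier J) :
    evalTensor d ι π v w ((hadamard (BiCom K) (Nov K)).relabel e σ) =
      evalTensor d ι π (fun j => v (e j)) (fun j => w (e j)) σ := by
  induction σ using hadamard_induction with
  | zero => rw [map_zero, map_zero, map_zero]
  | add x y hx hy => rw [map_add, map_add, map_add, hx, hy]
  | tmul b n =>
    refine (evalTensor_tmul d ι π v w _ _).trans ?_
    rw [evalTensor_tmul]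
    congr 1
    · exact congrArg (fun x => ι (π x)) (evalQuotient_relabel _ e v b)
    · exact evalQuotient_relabel _ e w n

variable (K) in
/-- The operations of arity two. -/
noncomputable def binaryOp (c c' : Bool) : (hadamard (BiCom K) (Nov K)).carrier (Fin 2) :=
  pureTensor (biComWord K (binaryWord c)) (novWord K (binaryWord c'))

variable {d ι}

/-- The two Booleans place the new letter on the left or right independently in the two factors.
Products of pairs lie on the diagonal, so `π` does not matter, while `σ` enters through its
coordinate opposite to that of the letter. The constants `ι s` pass through `d`. -/
theorem evalTensor_comp (hι : ∀ s, d (ι s) = 0) (π : S × S →ₗ[K] S) (hπ : ∀ s, π (s, s) = s)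
    {J : Type} [Finite J] (a : S × S) (x : D) (v : J → S × S) (w : J → D) (c c' : Bool)
    (σ : (hadamard (BiCom K) (Nov K)).carrier J) :
    evalTensor d ι π (Sum.elim (fun _ => a) v) (Sum.elim (fun _ => x) w)
        ((hadamard (BiCom K) (Nov K)).comp (1 : Fin 2) (binaryOp K c c') σ) =
      ι (if c then a.1 else a.2) *
        (if c' then x * d (evalTensor d ι (if c then LinearMap.snd K S S
            else LinearMap.fst K S S) v w σ)
          else d x * evalTensor d ι (if c then LinearMap.snd K S S
            else LinearMap.fst K S S) v w σ) := by
  induction σ using hadamard_induction with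
  | zero => cases c' <;> simp only [map_zero, mul_zero, if_true, if_false, Bool.false_eq_true]
  | add y z hy hz =>
    rw [map_add, map_add, hy, hz]
    cases c' <;> simp only [map_add, if_true, if_false, Bool.false_eq_true] <;> ring
  | tmul b n =>
    refine (evalTensor_tmul d ι π _ _ _ _).trans ?_
    rw [evalBiCom_comp, evalNov_comp, evalTensor_tmul]
    cases c <;> cases c' <;>
      simp only [if_true, if_false, Bool.false_eq_true, sideMul_apply, derMul_apply, hπ, map_mul,
        Derivation.leibniz, hι, smul_eq_mul, mul_zero, add_zero, LinearMap.fst_apply,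
        LinearMap.snd_apply] <;> ring

theorem evalTensor_binaryOp (π : S × S →ₗ[K] S) (hπ : ∀ s, π (s, s) = s)
    (v : Fin 2 → S × S) (w : Fin 2 → D) (c : Bool) :
    evalTensor d ι π v w (binaryOp K c true) =
      ι (if c then (v 0).1 * (v 1).2 else (v 1).1 * (v 0).2) * (w 0 * d (w 1)) := by
  rw [binaryOp, evalTensor_tmul, evalBiCom_word, evalNov_word]
  cases c <;> simp [binaryWord, hπ]

end BiComNov

/-! ### Evaluation in differential polynomials with sided letters. -/

namespace BiComNov

open SymmOperad Mag FreeMagma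

variable (K : Type u) [Field K] (I : Type)

/-- The polynomials in the sided letters. -/
abbrev SideRing := MvPolynomial (I × Bool) K

/-- The differential polynomials in the letters, over the polynomials in the sided letters. -/
abbrev DiffRing := MvPolynomial (I × ℕ) (SideRing K I)

/-- The derivation of the differential polynomials. -/
noncomputable def diff : Derivation K (DiffRing K I) (DiffRing K I) :=
  (MvPolynomial.mkDerivation (SideRing K I)
    fun q : I × ℕ => (MvPolynomial.X (q.1, q.2 + 1) : DiffRing K I)).restrictScalars K

/-- The inclusion of the constants. -/
noncomputable def const : SideRing K I →ₐ[K] DiffRing K I :=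
  IsScalarTower.toAlgHom K (SideRing K I) (DiffRing K I)

variable {K I}

theorem diff_const (s : SideRing K I) : diff K I (const K I s) = 0 :=
  Derivation.map_algebraMap (MvPolynomial.mkDerivation (SideRing K I)
    fun q : I × ℕ => (MvPolynomial.X (q.1, q.2 + 1) : DiffRing K I)) s

theorem diff_X (i : I) (k : ℕ) :
    diff K I (MvPolynomial.X (i, k)) = MvPolynomial.X (i, k + 1) :=
  MvPolynomial.mkDerivation_X _ _ _

variable (K) in
/-- The derivative of order `k` of the letter `i` on the side `s`. -/
noncomputable def sidedLetter (q : I × Bool × ℕ) : DiffRing K I :=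
  const K I (MvPolynomial.X (q.1, q.2.1)) * MvPolynomial.X (q.1, q.2.2)

theorem diff_sidedLetter (i : I) (s : Bool) (k : ℕ) :
    diff K I (sidedLetter K (i, s, k)) = sidedLetter K (i, s, k + 1) := by
  simp [sidedLetter, diff_const, diff_X]

variable (K) in
/-- The value of a letter in the bicommutative algebra. -/
noncomputable def sides (i : I) : SideRing K I × SideRing K I :=
  (MvPolynomial.X (i, true), MvPolynomial.X (i, false))

variable (K) in
/-- The value of a letter in the Novikov algebra. -/
noncomputable def letter (i : I) : DiffRing K I := MvPolynomial.X (i, 0)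

variable (π : SideRing K I × SideRing K I →ₗ[K] SideRing K I)

/-- The evaluation of the Hadamard product at letters. -/
noncomputable def evalLetters {J : Type} [Finite J] (f : J → I) :
    (hadamard (BiCom K) (Nov K)).carrier J →ₗ[K] DiffRing K I :=
  evalTensor (diff K I) (const K I) π (fun j => sides K (f j)) fun j => letter K (f j)

theorem evalLetters_comp (hπ : ∀ s, π (s, s) = s) {J : Type} [Finite J] (f : J → I) (i : I)
    (s c : Bool) (σ : (hadamard (BiCom K) (Nov K)).carrier J) :
    evalLetters π (Sum.elim (fun _ => i) f : Graft (Fin 2) 1 J → I)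
        ((hadamard (BiCom K) (Nov K)).comp (1 : Fin 2) (binaryOp K s c) σ) =
      if c then sidedLetter K (i, s, 0) * diff K I (evalLetters (if s then LinearMap.snd K _ _
          else LinearMap.fst K _ _) f σ)
        else sidedLetter K (i, s, 1) * evalLetters (if s then LinearMap.snd K _ _
          else LinearMap.fst K _ _) f σ := by
  have h1 : (fun j => sides K ((Sum.elim (fun _ => i) f : Graft (Fin 2) 1 J → I) j)) =
      Sum.elim (fun _ => sides K i) fun j => sides K (f j) := by
    funext j; rcases j with j | j <;> rfl
  have h2 : (fun j => letter K ((Sum.elim (fun _ => i) f : Graft (Fin 2) 1 J → I) j)) =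
      Sum.elim (fun _ => letter K i) fun j => letter K (f j) := by
    funext j; rcases j with j | j <;> rfl
  rw [evalLetters, h1, h2, evalTensor_comp diff_const π hπ]
  cases c <;> cases s <;>
    simp [sidedLetter, evalLetters, sides, letter, diff_X, mul_assoc]

variable (S : Suboperad (hadamard (BiCom K) (Nov K)))

variable (I) in
/-- The values at letters of the operations in a suboperad, sorted by the letters. -/
noncomputable def values (t : Multiset I) : Submodule K (DiffRing K I) :=
  Submodule.span K {x | ∃ (J : Type) (_ : Fintype J) (f : J → I)
    (σ : (hadamard (BiCom K) (Nov K)).carrier J), σ ∈ S.carrier J ∧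
      Finset.univ.val.map f = t ∧ evalLetters (LinearMap.fst K _ _) f σ = x ∧
      evalLetters (LinearMap.snd K _ _) f σ = x}

theorem univ_map_graft {J : Type} [Fintype J] [Fintype {k : Fin 2 // k ≠ 1}] (f : J → I) (i : I) :
    (Finset.univ : Finset ({k : Fin 2 // k ≠ 1} ⊕ J)).val.map (Sum.elim (fun _ => i) f) =
      i ::ₘ Finset.univ.val.map f := by
  have hu : (Finset.univ : Finset {k : Fin 2 // k ≠ 1}) = {⟨0, by decide⟩} := by
    ext ⟨k, hk⟩
    simp only [Finset.mem_univ, Finset.mem_singleton, true_iff, Subtype.mk.injEq]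
    omega
  rw [← Finset.univ_disjSum_univ, Finset.val_disjSum, hu, Multiset.disjSum]
  simp [Function.comp_def]

/-- The side of the new letter decides which coordinate of `σ` is read. The definition of `values`
requires both coordinates to agree, so either side is allowed; the new values are products and
satisfy this requirement again. -/
theorem closed_values (hS : S.carrier (Fin 2) = ⊤) :
    SidedMonomial.Closed (diff K I) (sidedLetter K) (values I S) where
  base i j s s' hs := by
    refine Submodule.subset_span ⟨Fin 2, inferInstance, ![i, j], binaryOp K s true,
      hS ▸ Submodule.mem_top, by rfl, ?_, ?_⟩
    all_goals
      rw [evalLetters, evalTensor_binaryOp _ fun _ => rfl]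
      cases s <;> cases s' <;> simp at hs <;>
        simp [sidedLetter, sides, letter, diff_X] <;> ring
  mul_deriv i s t p hp := by
    refine (Submodule.span_le (p := (values I S (i ::ₘ t)).comap
      (LinearMap.mulLeft K (sidedLetter K (i, s, 0)) ∘ₗ (diff K I).toLinearMap))).2 ?_ hp
    rintro _ ⟨J, _, f, σ, hσ, rfl, hx, hx'⟩
    classical
    refine Submodule.subset_span ⟨{k : Fin 2 // k ≠ 1} ⊕ J, inferInstance, Sum.elim (fun _ => i) f,
      (hadamard (BiCom K) (Nov K)).comp (1 : Fin 2) (binaryOp K s true) σ,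
      S.comp_mem _ (hS ▸ Submodule.mem_top) hσ, univ_map_graft f i, ?_, ?_⟩
    all_goals
      refine (evalLetters_comp _ (fun _ => rfl) f i s true σ).trans ?_
      cases s <;> simp [hx, hx']
  deriv_mul i s t p hp := by
    refine (Submodule.span_le (p := (values I S (i ::ₘ t)).comap
      (LinearMap.mulLeft K (sidedLetter K (i, s, 1))))).2 ?_ hp
    rintro _ ⟨J, _, f, σ, hσ, rfl, hx, hx'⟩
    classical
    refine Submodule.subset_span ⟨{k : Fin 2 // k ≠ 1} ⊕ J, inferInstance, Sum.elim (fun _ => i) f,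
      (hadamard (BiCom K) (Nov K)).comp (1 : Fin 2) (binaryOp K s false) σ,
      S.comp_mem _ (hS ▸ Submodule.mem_top) hσ, univ_map_graft f i, ?_, ?_⟩
    all_goals
      refine (evalLetters_comp _ (fun _ => rfl) f i s false σ).trans ?_
      cases s <;> simp [hx, hx']

/-- A labelling that uses each letter exactly once is a bijection, and `S` is stable under
relabelling. -/
theorem values_univ_le [Fintype I] :
    values I S Finset.univ.val ≤ (S.carrier I).map (evalLetters (LinearMap.fst K _ _) id) := by
  refine Submodule.span_le.2 ?_
  rintro _ ⟨J, _, f, σ, hσ, hf, rfl, -⟩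
  have hinj : Function.Injective f := by
    intro a b hab
    have h1 : (Finset.univ.val.map f).Nodup := hf ▸ Finset.univ.nodup
    exact Multiset.inj_on_of_nodup_map h1 a (Finset.mem_univ a) b (Finset.mem_univ b) hab
  have hsurj : Function.Surjective f := by
    intro i
    have h1 : i ∈ Finset.univ.val.map f := hf ▸ Finset.mem_univ i
    obtain ⟨j, -, hj⟩ := Multiset.mem_map.1 h1
    exact ⟨j, hj⟩
  refine ⟨_, S.relabel_mem (Equiv.ofBijective f ⟨hinj, hsurj⟩) hσ, ?_⟩
  exact evalTensor_relabel _ _ _ _ _ _ _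

/-! ### Linear independence and count of the two-sided monomials. -/

section independent

variable [Fintype I] [DecidableEq I]

/-- The sided monomial with given sides and orders of derivatives. -/
def sidedMonomial (A : I → Bool) (a : I → ℕ) : Multiset (I × Bool × ℕ) :=
  Finset.univ.val.map fun i => (i, A i, a i)

omit [DecidableEq I] in
theorem value_sidedMonomial (A : I → Bool) (a : I → ℕ) :
    SidedMonomial.value (sidedLetter K) (sidedMonomial A a) =
      const K I (∏ i, MvPolynomial.X (i, A i)) * ∏ i, MvPolynomial.X (i, a i) := by
  rw [SidedMonomial.value, sidedMonomial, Multiset.map_map, map_prod, ← Finset.prod_mul_distrib]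
  rfl

variable (I) in
/-- The choices of sides that are not constant. -/
def sideChoices : Finset (I → Bool) :=
  Finset.univ \ {fun _ => true, fun _ => false}

theorem card_sideChoices [Nonempty I] : (sideChoices I).card = 2 ^ Fintype.card I - 2 := by
  rw [sideChoices, Finset.card_sdiff_of_subset (Finset.subset_univ _), Finset.card_univ,
    Fintype.card_fun, Fintype.card_bool, Finset.card_pair]
  intro h
  exact Bool.true_eq_false_eq_False (congrFun h (Classical.arbitrary I))

variable (K) in
-- The values are members of the monomial basis of a polynomial ring over a polynomial ring, and
-- their exponents recover the sides and the orders.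
theorem linearIndependent_value :
    LinearIndependent K fun p : (I → Bool) × (I → ℕ) =>
      SidedMonomial.value (sidedLetter K) (sidedMonomial p.1 p.2) := by
  have hinj : ∀ {L : Type}, Function.Injective fun (a : I → L) =>
      ∑ i, Finsupp.single (i, a i) 1 := by
    classical
    intro L a b hab
    funext i
    have := DFunLike.congr_fun hab (i, a i)
    simp only [Finsupp.coe_finsetSum, Finset.sum_apply, Finsupp.single_apply] at this
    by_contra hne
    rw [Finset.sum_eq_single i (by intro j _ hj; rw [if_neg]; intro e; exact hj (Prod.mk.inj e).1)
      (by simp), if_pos rfl, Finset.sum_eq_zero] at this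
    · exact one_ne_zero this
    · intro j _
      rw [if_neg]
      intro e
      obtain ⟨rfl, e⟩ := Prod.mk.inj e
      exact hne e.symm
  have h := ((MvPolynomial.basisMonomials (I × Bool) K).smulTower
    (MvPolynomial.basisMonomials (I × ℕ) (SideRing K I))).linearIndependent.comp
      (fun p : (I → Bool) × (I → ℕ) =>
        (∑ i, Finsupp.single (i, p.1 i) 1, ∑ i, Finsupp.single (i, p.2 i) 1))
      (fun p q hpq => Prod.ext (hinj (Prod.mk.inj hpq).1) (hinj (Prod.mk.inj hpq).2))
  have heq : (fun p : (I → Bool) × (I → ℕ) =>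
      SidedMonomial.value (sidedLetter K) (sidedMonomial p.1 p.2)) =
        ((MvPolynomial.basisMonomials (I × Bool) K).smulTower
          (MvPolynomial.basisMonomials (I × ℕ) (SideRing K I))) ∘
        fun p : (I → Bool) × (I → ℕ) =>
          (∑ i, Finsupp.single (i, p.1 i) 1, ∑ i, Finsupp.single (i, p.2 i) 1) := by
    funext p
    rw [value_sidedMonomial, Function.comp_apply, Module.Basis.smulTower_apply,
      MvPolynomial.coe_basisMonomials, MvPolynomial.coe_basisMonomials]
    simp only [MvPolynomial.monomial_sum_one]
    rw [Algebra.smul_def]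
    rfl
  rw [heq]
  exact h

theorem le_finrank_carrier (hS : S.carrier (Fin 2) = ⊤) (hI : 2 ≤ Fintype.card I)
    [Module.Finite K ((hadamard (BiCom K) (Nov K)).carrier I)] :
    (2 ^ Fintype.card I - 2) * (2 * Fintype.card I - 2).choose (Fintype.card I - 1) ≤
      Module.finrank K (S.carrier I) := by
  have : Nonempty I := Fintype.card_pos_iff.1 (by omega)
  -- Non-constant sides make the monomial two-sided; orders with sum n - 1 give it the weight
  -- required by `value_mem`.
  let s := sideChoices I ×ˢ Finset.piAntidiag (Finset.univ : Finset I) (Fintype.card I - 1)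
  have hcard : s.card =
      (2 ^ Fintype.card I - 2) * (2 * Fintype.card I - 2).choose (Fintype.card I - 1) := by
    rw [Finset.card_product, card_sideChoices, Novikov.card_piAntidiag_univ]
  have hli := (linearIndependent_value (I := I) K).comp (Subtype.val : s → _)
    Subtype.val_injective
  have hmem : ∀ p : s, SidedMonomial.value (sidedLetter K) (sidedMonomial p.1.1 p.1.2) ∈
      (S.carrier I).map (evalLetters (LinearMap.fst K _ _) id) := by
    rintro ⟨⟨A, a⟩, hp⟩
    obtain ⟨hA, ha⟩ := Finset.mem_product.1 hp
    refine values_univ_le S ?_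
    have h1 := (closed_values (I := I) S hS).value_mem diff_sidedLetter (m := sidedMonomial A a)
      ?_ ?_
    · convert h1 using 1
      simp [SidedMonomial.content, sidedMonomial]
    · have h2 : ∑ i, a i = Fintype.card I - 1 := (Finset.mem_piAntidiag.1 ha).1
      have h3 : SidedMonomial.order (sidedMonomial A a) = ∑ i, a i := by
        rw [SidedMonomial.order, sidedMonomial, Multiset.map_map]; rfl
      have h4 : (sidedMonomial A a).card = Fintype.card I := by
        rw [sidedMonomial, Multiset.card_map]; rfl
      omega
    · simp only [sideChoices, Finset.mem_sdiff, Finset.mem_univ, true_and, Finset.mem_insert,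
        Finset.mem_singleton, not_or, funext_iff, not_forall] at hA
      obtain ⟨⟨i, hi⟩, j, hj⟩ := hA
      refine ⟨(i, A i, a i), Multiset.mem_map_of_mem _ (Finset.mem_univ i), (j, A j, a j),
        Multiset.mem_map_of_mem _ (Finset.mem_univ j), ?_⟩
      simp only [Bool.not_eq_true, Bool.not_eq_false] at hi hj
      simp [hi, hj]
  have h5 : LinearIndependent K fun p : s =>
      (⟨_, hmem p⟩ : (S.carrier I).map (evalLetters (LinearMap.fst K _ _) id)) :=
    LinearIndependent.of_comp (Submodule.subtype _) hli
  have h6 := h5.fintype_card_le_finrank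
  rw [Fintype.card_coe, hcard] at h6
  exact h6.trans (Submodule.finrank_map_le _ _)

end independent

theorem finite_and_finrank_le [Fintype I] (hI : 2 ≤ Fintype.card I) :
    Module.Finite K ((hadamard (BiCom K) (Nov K)).carrier I) ∧
      Module.finrank K ((hadamard (BiCom K) (Nov K)).carrier I) ≤
        (2 ^ Fintype.card I - 2) * (2 * Fintype.card I - 2).choose (Fintype.card I - 1) := by
  obtain ⟨h1, h2⟩ := Bicommutative.finrank_le K I hI
  obtain ⟨h3, h4⟩ := Novikov.finrank_le K I
  refine ⟨Module.Finite.tensorProduct K ((BiCom K).carrier I) ((Nov K).carrier I), ?_⟩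
  refine (Module.finrank_tensorProduct (R := K) (S := K) (M := (BiCom K).carrier I)
    (M' := (Nov K).carrier I)).le.trans ?_
  exact Nat.mul_le_mul h2 h4

/-- The lower bound for `S` equals the upper bound for the whole Hadamard product. -/
theorem carrier_eq_top_and_finrank [Fintype I] (hS : S.carrier (Fin 2) = ⊤)
    (hI : 2 ≤ Fintype.card I) :
    S.carrier I = ⊤ ∧ Module.finrank K (S.carrier I) =
      (2 ^ Fintype.card I - 2) * (2 * Fintype.card I - 2).choose (Fintype.card I - 1) := by
  classical
  obtain ⟨h1, h2⟩ := finite_and_finrank_le (K := K) hI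
  have h3 := le_finrank_carrier S hS hI
  have h4 := Submodule.finrank_le (S.carrier I)
  exact ⟨Submodule.eq_top_of_finrank_eq (by omega), by omega⟩

/-- There are no words without letters, and the only words in one letter are relabellings of the
unit, which every suboperad contains. -/
theorem carrier_eq_top_of_card_le_one [Fintype I] (hI : Fintype.card I ≤ 1) :
    S.carrier I = ⊤ := by
  have hsub := Fintype.card_le_one_iff_subsingleton.1 hI
  have hword : ∀ t : MultilinearWord I, ∃ e : Unit ≃ I,
      t = MultilinearWord.relabel e MultilinearWord.unit := by
    rintro ⟨t, ht, hu⟩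
    rcases t with i | ⟨s, t⟩
    · exact ⟨⟨fun _ => i, fun _ => (), fun _ => rfl, fun _ => Subsingleton.elim _ _⟩, rfl⟩
    · exfalso
      have hne : ∀ r : FreeMagma I, ∃ i, i ∈ r.letters := by
        intro r
        induction r using FreeMagma.recOnMul with
        | ih1 i => exact ⟨i, by simp [letters]⟩
        | ih2 a b ha _ =>
          obtain ⟨i, hi⟩ := ha
          exact ⟨i, List.mem_append_left _ hi⟩
      obtain ⟨i, hi⟩ := hne s
      obtain ⟨j, hj⟩ := hne t
      exact (List.nodup_append.1 ht).2.2 i hi j hj (Subsingleton.elim i j)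
  have hmem : ∀ t t' : MultilinearWord I,
      pureTensor (biComWord K t) (novWord K t') ∈ S.carrier I := by
    intro t t'
    obtain ⟨e, rfl⟩ := hword t
    obtain ⟨e', rfl⟩ := hword t'
    obtain rfl : e = e' := Equiv.ext fun _ => Subsingleton.elim _ _
    have h1 := S.relabel_mem e S.one_mem
    convert h1 using 1
    change _ = pureTensor (mk _ I ((Mag K).relabel e (word MultilinearWord.unit)))
      (mk _ I ((Mag K).relabel e (word MultilinearWord.unit)))
    rw [relabel_word]
    rfl
  have hB : ∀ b t', pureTensor b (novWord K t') ∈ S.carrier I := by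
    intro b t'
    obtain ⟨b, rfl⟩ := mk_surjective _ I b
    have hb : b ∈ Submodule.span K (Set.range word) := span_range_word (K := K) I ▸ trivial
    refine (Submodule.span_le (p := (S.carrier I).comap
      ((TensorProduct.mk K ((BiCom K).carrier I) ((Nov K).carrier I)).flip (novWord K t') ∘ₗ
        mk (OperadIdeal.span (Mag K) (Bicommutative.relations K)) I))).2 ?_ hb
    rintro _ ⟨t, rfl⟩
    exact hmem t t'
  refine eq_top_iff.2 fun σ _ => ?_
  induction σ using hadamard_induction with
  | zero => exact zero_mem _
  | add x y hx hy => exact add_mem (hx trivial) (hy trivial)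
  | tmul b n =>
    obtain ⟨n, rfl⟩ := mk_surjective _ I n
    have hn : n ∈ Submodule.span K (Set.range word) := span_range_word (K := K) I ▸ trivial
    refine (Submodule.span_le (p := (S.carrier I).comap
      (TensorProduct.mk K ((BiCom K).carrier I) ((Nov K).carrier I) b ∘ₗ
        mk (OperadIdeal.span (Mag K) (Novikov.relations K)) I))).2 ?_ hn
    rintro _ ⟨t, rfl⟩
    exact hB b t

theorem generatedByBinary_carrier_fin_two (P : SymmOperad K) :
    (Suboperad.generatedByBinary P).carrier (Fin 2) = ⊤ := by
  refine eq_top_iff.2 fun a _ => ?_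
  change a ∈ ⨅ (S : Suboperad P) (_ : S.carrier (Fin 2) = ⊤), S.carrier (Fin 2)
  simp only [Submodule.mem_iInf]
  exact fun S hS => hS ▸ Submodule.mem_top

end BiComNov

theorem mainTheorem5 (K : Type u) [Field K] :
    SymmOperad.whiteManin (BiCom K) (Nov K) = ⊤ ∧
      ∀ n : ℕ, 2 ≤ n →
        Module.finrank K ((Der (BiCom K)).carrier (Fin n)) =
          (2 ^ n - 2) * Nat.choose (2 * n - 2) (n - 1) := by
  have hS := BiComNov.generatedByBinary_carrier_fin_two
    (SymmOperad.hadamard (BiCom K) (Nov K))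
  constructor
  · refine SymmOperad.Suboperad.ext ?_
    funext I hI
    have := Fintype.ofFinite I
    rcases Nat.lt_or_ge (Fintype.card I) 2 with h | h
    · exact BiComNov.carrier_eq_top_of_card_le_one _ (by omega)
    · exact (BiComNov.carrier_eq_top_and_finrank _ hS h).1
  · intro n hn
    have h := (BiComNov.carrier_eq_top_and_finrank (I := Fin n)
      (SymmOperad.whiteManin (BiCom K) (Nov K)) hS (by simpa using hn)).2
    rw [Fintype.card_fin] at h
    exact h
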